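/- In the problem $R2||C_{\max}$ the input consists of $n$ jobs and processing times $p_{i,j}\in\mathbb N=\{0,1,2,\dots\}$ for $i\in\{1,2\}$ and $j\in\{1,\dots,n\}$, where $p_{i,j}$ is the time that machine $i$ needs for job $j$. A schedule is a map $\sigma:\{1,\dots,n\}\to\{1,2\}$, its makespan is $C_{\max}(\sigma)=\max_{i\in\{1,2\}}\sum_{j:\,\sigma(j)=i}p_{i,j}$, and the task is to compute a schedule of minimum makespan together with its makespan. Let $p_{\max}=\max_{i,j}p_{i,j}$ (and $p_{\max}=0$ if $n=0$). **Corollary.** $R2||C_{\max}$ can be solved in $\widetilde O(p_{\max}^6\cdot n)$ time, where $\widetilde O$ suppresses polylogarithmic factors. That is, there are a single program for a random access machine and constants $K,k\in\mathbb N$ such that, on every instance, the program halts with an optimal schedule and the optimal makespan as its output, after running for time at most $$K\cdot \max(p_{\max},1)^6\cdot \max(n,1)\cdot \lfloor\log_2(n+p_{\max}+2)\rfloor^{k}.$$ Here the machine stores natural numbers in its registers and memory cells, has indirect addressing, addition, truncated subtraction, multiplication, integer division and comparisons, and running time is measured by the logarithmic cost criterion: each elementary step costs one plus the total bit length of the numbers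 it handles, including memory addresses. -/

import Mathlib

/-! ## Makespan minimization on unrelated parallel machines -/

namespace Makespan

/-- The total load that the assignment `σ` puts on machine `i`, where `p i j` is the time that
machine `i` needs for job `j`. -/
def load {m n : ℕ} (p : Fin m → Fin n → ℕ) (σ : Fin n → Fin m) (i : Fin m) : ℕ :=
  ∑ j ∈ Finset.univ.filter (fun j => σ j = i), p i j

/-- The makespan of the assignment `σ`: the largest load of a machine. -/
def makespan {m n : ℕ} (p : Fin m → Fin n → ℕ) (σ : Fin n → Fin m) : ℕ :=
  Finset.univ.sup (load p σ)

/-- `σ` is a schedule of minimum makespan. -/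
def IsOptimal {m n : ℕ} (p : Fin m → Fin n → ℕ) (σ : Fin n → Fin m) : Prop :=
  ∀ τ : Fin n → Fin m, makespan p σ ≤ makespan p τ

/-- The largest time `p i j` over all machines and jobs (`0` if there are none). -/
def pmax {m n : ℕ} (p : Fin m → Fin n → ℕ) : ℕ :=
  Finset.univ.sup fun i => Finset.univ.sup fun j => p i j

end Makespan

/-! ## Random access machines with logarithmic cost

A machine has named registers and a memory whose cells are addressed by natural numbers; registers
and cells hold natural numbers. A program is a finite text, so it names only finitely many
registers. Each elementary step costs one plus the bit lengths of the numbers it handles,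
addresses included. -/

namespace RAM

/-- Register contents and memory contents. -/
structure State where
  reg : ℕ → ℕ
  mem : ℕ → ℕ

/-- Write the value `v` into register `x`. -/
def State.setReg (s : State) (x v : ℕ) : State :=
  { s with reg := Function.update s.reg x v }

/-- Write the value `v` into memory cell `a`. -/
def State.setMem (s : State) (a v : ℕ) : State :=
  { s with mem := Function.update s.mem a v }

/-- Arithmetic operations on natural numbers. -/
inductive Op where
  | add | sub | mul | div

/-- Subtraction is truncated at `0`; division rounds down, and division by `0` yields `0`. -/
def Op.eval : Op → ℕ → ℕ → ℕ
  | .add, a, b => a + b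
  | .sub, a, b => a - b
  | .mul, a, b => a * b
  | .div, a, b => a / b

/-- Programs. All arguments `x y z` are names of registers. -/
inductive Program where
  /-- do nothing -/
  | skip : Program
  /-- `x := k` for a constant `k` of the program -/
  | const (x k : ℕ) : Program
  /-- `x := y op z` -/
  | arith (op : Op) (x y z : ℕ) : Program
  /-- `x := mem[y]` -/
  | load (x y : ℕ) : Program
  /-- `mem[x] := y` -/
  | store (x y : ℕ) : Program
  /-- `c; d` -/
  | seq (c d : Program) : Program
  /-- `if x < y then c else d` -/
  | ite (x y : ℕ) (c d : Program) : Program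
  /-- `while x < y do c` -/
  | loop (x y : ℕ) (c : Program) : Program

/-- `Exec c s s' t`: started in state `s`, the program `c` halts in state `s'`, and the total cost
of the steps it makes is `t`. Here `Nat.size` is the bit length of a number. -/
inductive Exec : Program → State → State → ℕ → Prop
  | skip (s : State) : Exec .skip s s 1
  | const (s : State) (x k : ℕ) : Exec (.const x k) s (s.setReg x k) (1 + k.size)
  | arith (s : State) (op : Op) (x y z : ℕ) :
      Exec (.arith op x y z) s (s.setReg x (op.eval (s.reg y) (s.reg z)))
        (1 + (s.reg y).size + (s.reg z).size)
  | load (s : State) (x y : ℕ) :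
      Exec (.load x y) s (s.setReg x (s.mem (s.reg y)))
        (1 + (s.reg y).size + (s.mem (s.reg y)).size)
  | store (s : State) (x y : ℕ) :
      Exec (.store x y) s (s.setMem (s.reg x) (s.reg y))
        (1 + (s.reg x).size + (s.reg y).size)
  | seq {c d : Program} {s s' s'' : State} {t t' : ℕ} :
      Exec c s s' t → Exec d s' s'' t' → Exec (.seq c d) s s'' (t + t')
  | ite_true {x y : ℕ} {c d : Program} {s s' : State} {t : ℕ} :
      s.reg x < s.reg y → Exec c s s' t →
        Exec (.ite x y c d) s s' (1 + (s.reg x).size + (s.reg y).size + t)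
  | ite_false {x y : ℕ} {c d : Program} {s s' : State} {t : ℕ} :
      ¬ s.reg x < s.reg y → Exec d s s' t →
        Exec (.ite x y c d) s s' (1 + (s.reg x).size + (s.reg y).size + t)
  | loop_true {x y : ℕ} {c : Program} {s s' s'' : State} {t t' : ℕ} :
      s.reg x < s.reg y → Exec c s s' t → Exec (.loop x y c) s' s'' t' →
        Exec (.loop x y c) s s'' (1 + (s.reg x).size + (s.reg y).size + t + t')
  | loop_false {x y : ℕ} {c : Program} {s : State} :
      ¬ s.reg x < s.reg y →
        Exec (.loop x y c) s s (1 + (s.reg x).size + (s.reg y).size)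

end RAM

/-! ## The two-machine problem as a task for such machines -/

namespace Makespan

/-- The initial state for an instance with two machines and `n` jobs: register `0` holds `n`, and
for each job `j < n` the cells `2 * j` and `2 * j + 1` hold its times on the two machines. All
other registers and cells hold `0`. -/
def inputState {n : ℕ} (p : Fin 2 → Fin n → ℕ) : RAM.State where
  reg x := if x = 0 then n else 0
  mem a := if h : a / 2 < n then p ⟨a % 2, Nat.mod_lt a Nat.two_pos⟩ ⟨a / 2, h⟩ else 0

/-- The state `s` shows a solution of the instance `p`: for some schedule `σ` of minimum makespan,
cell `j` holds the machine (`0` or `1`) of job `j`, and register `0` holds the makespan. -/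
def IsSolution {n : ℕ} (p : Fin 2 → Fin n → ℕ) (s : RAM.State) : Prop :=
  ∃ σ : Fin n → Fin 2, IsOptimal p σ ∧ (∀ j : Fin n, s.mem j = σ j) ∧ s.reg 0 = makespan p σ

/-- `c` solves every instance `p` of the two-machine problem at a total cost of at most `T n p`. -/
def SolvesWithin (c : RAM.Program) (T : (n : ℕ) → (Fin 2 → Fin n → ℕ) → ℕ) : Prop :=
  ∀ (n : ℕ) (p : Fin 2 → Fin n → ℕ), ∃ (s : RAM.State) (t : ℕ),
    RAM.Exec c (inputState p) s t ∧ IsSolution p s ∧ t ≤ T n p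

end Makespan

/-
A dynamic program over a narrow window of loads needs a table of only `O(n * P ^ 4)` entries, where
`P` is the largest time (at least `1`). Consider the greedy schedule `G` that moves jobs to the
first machine in the order of their ratios `p₁ j / p₀ j`, the largest ratios first, until the loads
are balanced up to `2 * P`. In an optimal schedule `S` that differs from `G` in as few jobs as
possible, `G \ S` and `S \ G` cannot both have `P ^ 2` jobs: by pigeonhole, `P` jobs of the one set
would have the same time `v` on the first machine and `P` jobs of the other the same time `w`, and
as `G` is sorted, exchanging `w` of the former for `v` of the latter would give a schedule that is
no worse and closer to `G`. Hence the loads of the first machine under `S` and `G`, restricted to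
any prefix of the jobs, differ by `O(P ^ 4)`, and so it suffices to tabulate the largest saving on
the second machine for each prefix and each deviation in this window.
-/

namespace RAM

variable {B N N' x y : ℕ} {c d : Program} {s s' : State} {Q R : State → Prop}

theorem State.setReg_reg (s : State) (x v y : ℕ) :
    (s.setReg x v).reg y = if y = x then v else s.reg y := by
  simp only [State.setReg, Function.update_apply]

theorem State.setReg_mem (s : State) (x v : ℕ) : (s.setReg x v).mem = s.mem := rfl

theorem State.setMem_reg (s : State) (a v : ℕ) : (s.setMem a v).reg = s.reg := rfl

theorem State.setMem_mem (s : State) (a v : ℕ) :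
    (s.setMem a v).mem = Function.update s.mem a v := rfl

/-- Run the programs in a list one after the other. -/
def Program.block : List Program → Program
  | [] => .skip
  | [c] => c
  | c :: l => .seq c (block l)

/-! ### Registers that a program leaves alone -/

/-- The registers that occur as the target of an assignment in a program. -/
def Program.writes : Program → List ℕ
  | .skip | .store _ _ => []
  | .const x _ | .arith _ x _ _ | .load x _ => [x]
  | .seq c d | .ite _ _ c d => c.writes ++ d.writes
  | .loop _ _ c => c.writes

/-- The states `s` and `s'` agree on all registers outside the list `l`. -/
def State.AgreeOff (l : List ℕ) (s s' : State) : Prop := ∀ x ∉ l, s'.reg x = s.reg x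

theorem State.agreeOff_setReg (s : State) (x v : ℕ) : s.AgreeOff [x] (s.setReg x v) :=
  fun y hy => by rw [setReg_reg, if_neg (by simpa using hy)]

theorem State.AgreeOff.mono {l l' : List ℕ} (h : s.AgreeOff l s') (hl : l ⊆ l') :
    s.AgreeOff l' s' :=
  fun x hx => h x fun hx' => hx (hl hx')

theorem State.AgreeOff.trans {l : List ℕ} {s'' : State} (h : s.AgreeOff l s')
    (h' : s'.AgreeOff l s'') : s.AgreeOff l s'' :=
  fun x hx => (h' x hx).trans (h x hx)

theorem Exec.agreeOff_writes {t : ℕ} (h : Exec c s s' t) : s.AgreeOff c.writes s' := by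
  induction h with
  | skip | store | loop_false => exact fun _ _ => rfl
  | const | arith | load => exact State.agreeOff_setReg _ _ _
  | seq _ _ ihc ihd =>
    exact (ihc.mono (List.subset_append_left _ _)).trans (ihd.mono (List.subset_append_right _ _))
  | ite_true _ _ ih => exact ih.mono (List.subset_append_left _ _)
  | ite_false _ _ ih => exact ih.mono (List.subset_append_right _ _)
  | loop_true _ _ _ ihc ihl => exact ihc.trans ihl

/-! ### Total correctness with a bound on the numbers and on the number of steps -/

/-- All registers and memory cells hold numbers at most `B`. -/
structure State.BoundedBy (B : ℕ) (s : State) : Prop where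
  reg : ∀ x, s.reg x ≤ B
  mem : ∀ a, s.mem a ≤ B

/-- Total correctness: if the numbers in the state `s` are at most `B`, then the program `c`,
started in `s`, halts in a state with the same property that satisfies `Q`. The time is at most that
of `N` steps, where `2 * B.size + 1` bounds the cost of a step that handles two numbers up to `B`.
-/
def Reaches (B N : ℕ) (c : Program) (s : State) (Q : State → Prop) : Prop :=
  s.BoundedBy B → ∃ s' t, Exec c s s' t ∧ t ≤ N * (2 * B.size + 1) ∧ s'.BoundedBy B ∧ Q s'

theorem State.BoundedBy.setReg (h : s.BoundedBy B) (x : ℕ) {v : ℕ} (hv : v ≤ B) :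
    (s.setReg x v).BoundedBy B where
  reg y := by rw [setReg_reg]; split; exacts [hv, h.reg y]
  mem := h.mem

theorem State.BoundedBy.setMem (h : s.BoundedBy B) (a : ℕ) {v : ℕ} (hv : v ≤ B) :
    (s.setMem a v).BoundedBy B where
  reg := h.reg
  mem y := by rw [setMem_mem, Function.update_apply]; split; exacts [hv, h.mem y]

theorem Reaches.mono (h : Reaches B N c s Q) (hN : N ≤ N') (hQ : ∀ s', Q s' → R s') :
    Reaches B N' c s R := by
  intro hs
  obtain ⟨s', t, hexec, ht, hs', hQs'⟩ := h hs
  exact ⟨s', t, hexec, ht.trans (Nat.mul_le_mul_right _ hN), hs', hQ s' hQs'⟩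

theorem Reaches.and_agreeOff (h : Reaches B N c s Q) :
    Reaches B N c s fun s' => Q s' ∧ s.AgreeOff c.writes s' := by
  intro hs
  obtain ⟨s', t, hexec, ht, hs', hQ⟩ := h hs
  exact ⟨s', t, hexec, ht, hs', hQ, hexec.agreeOff_writes⟩

theorem Reaches.seq (hc : Reaches B N c s R)
    (hd : ∀ s', s.AgreeOff c.writes s' → R s' → Reaches B N' d s' Q) :
    Reaches B (N + N') (.seq c d) s Q := by
  intro hs
  obtain ⟨s', t, hexec, ht, hs', hR, hagree⟩ := hc.and_agreeOff hs
  obtain ⟨s'', t', hexec', ht', hs'', hQ⟩ := hd s' hagree hR hs'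
  exact ⟨s'', t + t', .seq hexec hexec', by rw [add_mul]; omega, hs'', hQ⟩

/-- The weakest precondition of a program without loops that ensures `Q` and keeps all numbers at
most `B`. Loops are handled by the rule `Reaches.forLoop` instead. -/
def wp (B : ℕ) : Program → (State → Prop) → State → Prop
  | .skip, Q, s => Q s
  | .const x k, Q, s => k ≤ B ∧ Q (s.setReg x k)
  | .arith op x y z, Q, s => op.eval (s.reg y) (s.reg z) ≤ B ∧
      Q (s.setReg x (op.eval (s.reg y) (s.reg z)))
  | .load x y, Q, s => Q (s.setReg x (s.mem (s.reg y)))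
  | .store x y, Q, s => Q (s.setMem (s.reg x) (s.reg y))
  | .seq c d, Q, s => wp B c (wp B d Q) s
  | .ite x y c d, Q, s => if s.reg x < s.reg y then wp B c Q s else wp B d Q s
  | .loop _ _ _, _, _ => False

/-- The largest number of steps that a program without loops can make. -/
def Program.steps : Program → ℕ
  | .seq c d => c.steps + d.steps
  | .ite _ _ c d => 1 + max c.steps d.steps
  | _ => 1

theorem Reaches.of_wp_steps (h : wp B c Q s) : Reaches B c.steps c s Q := by
  induction c generalizing s Q with
  | seq c d ihc ihd => exact (ihc h).seq fun s' _ hs' => ihd hs'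
  | loop => exact h.elim
  | skip => exact fun hs => ⟨s, 1, .skip s, by simp only [Program.steps]; omega, hs, h⟩
  | const x k =>
    intro hs
    have hk := Nat.size_le_size h.1
    exact ⟨_, _, .const s x k, by simp only [Program.steps]; omega, hs.setReg x h.1, h.2⟩
  | arith op x y z =>
    intro hs
    have hy := Nat.size_le_size (hs.reg y)
    have hz := Nat.size_le_size (hs.reg z)
    exact ⟨_, _, .arith s op x y z, by simp only [Program.steps]; omega, hs.setReg x h.1, h.2⟩
  | load x y =>
    intro hs
    have hy := Nat.size_le_size (hs.reg y)
    have hmem := Nat.size_le_size (hs.mem (s.reg y))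
    exact ⟨_, _, .load s x y, by simp only [Program.steps]; omega, hs.setReg x (hs.mem _), h⟩
  | store x y =>
    intro hs
    have hx := Nat.size_le_size (hs.reg x)
    have hy := Nat.size_le_size (hs.reg y)
    exact ⟨_, _, .store s x y, by simp only [Program.steps]; omega, hs.setMem _ (hs.reg _), h⟩
  | ite x y c d ihc ihd =>
    intro hs
    have hx := Nat.size_le_size (hs.reg x)
    have hy := Nat.size_le_size (hs.reg y)
    rw [wp] at h
    split at h
    case isTrue hxy =>
      obtain ⟨s', t, hexec, ht, hs', hQ⟩ := (ihc h).mono (le_max_left _ d.steps) (fun _ => id) hs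
      exact ⟨s', _, .ite_true hxy hexec, by rw [Program.steps, add_mul]; omega, hs', hQ⟩
    case isFalse hxy =>
      obtain ⟨s', t, hexec, ht, hs', hQ⟩ := (ihd h).mono (le_max_right c.steps _) (fun _ => id) hs
      exact ⟨s', _, .ite_false hxy hexec, by rw [Program.steps, add_mul]; omega, hs', hQ⟩

theorem Reaches.of_wp (hN : c.steps ≤ N) (h : wp B c Q s) : Reaches B N c s Q :=
  (of_wp_steps h).mono hN fun _ => id

theorem Reaches.loop_of_not_lt (hxy : ¬ s.reg x < s.reg y) (hQ : Q s) :
    Reaches B 1 (.loop x y c) s Q := by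
  intro hs
  have hx := Nat.size_le_size (hs.reg x)
  have hy := Nat.size_le_size (hs.reg y)
  exact ⟨s, _, .loop_false hxy, by omega, hs, hQ⟩

theorem Reaches.loop_of_lt (hxy : s.reg x < s.reg y) (hc : Reaches B N c s R)
    (hloop : ∀ s', s.AgreeOff c.writes s' → R s' → Reaches B N' (.loop x y c) s' Q) :
    Reaches B (N + N' + 1) (.loop x y c) s Q := by
  intro hs
  have hx := Nat.size_le_size (hs.reg x)
  have hy := Nat.size_le_size (hs.reg y)
  obtain ⟨s', t, hexec, ht, hs', hR, hagree⟩ := hc.and_agreeOff hs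
  obtain ⟨s'', t', hexec', ht', hs'', hQ⟩ := hloop s' hagree hR hs'
  exact ⟨s'', _, .loop_true hxy hexec hexec', by simp only [add_mul, one_mul]; omega, hs'', hQ⟩

/-- Run `c` for all values of register `i` from its current one up to the one before that of
register `m`. Register `u` is supposed to hold `1`. -/
def Program.forLoop (i m u : ℕ) (c : Program) : Program := .loop i m (.seq c (.arith .add i i u))

/-- The rule for counting loops. Besides the invariant `I`, the body may use that the registers that
the loop does not write are as in the beginning. -/
theorem Reaches.forLoop {i m u lo hi : ℕ} {I : ℕ → State → Prop}
    (hwrites : ∀ x ∈ [i, m, u], x ∉ c.writes) (hi_notMem : i ∉ [m, u])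
    (hlo : s.reg i = lo) (hm : s.reg m = hi) (hu : s.reg u = 1) (hle : lo ≤ hi) (hI : I lo s)
    (hbody : ∀ k s', lo ≤ k → k < hi → s'.reg i = k →
      s.AgreeOff (Program.forLoop i m u c).writes s' → I k s' →
      Reaches B N c s' fun s'' => I (k + 1) (s''.setReg i (k + 1))) :
    Reaches B ((hi - lo) * (N + 2) + 1) (.forLoop i m u c) s (I hi) := by
  subst hlo
  have hi_ne : m ≠ i ∧ u ≠ i := by simpa [eq_comm] using hi_notMem
  obtain ⟨rounds, hrounds⟩ := Nat.exists_eq_add_of_le hle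
  rw [Nat.sub_eq_of_eq_add' hrounds]
  induction rounds generalizing s with
  | zero =>
    rw [Nat.zero_mul, Nat.zero_add]
    exact .loop_of_not_lt (by omega) (by rwa [hrounds])
  | succ rounds ih =>
    have hi_lt : s.reg i < s.reg m := by omega
    intro hs
    have hmB := hs.reg m
    have hround : Reaches B (N + 1) (.seq c (.arith .add i i u)) s
        fun s' => s'.reg i = s.reg i + 1 ∧ s'.reg m = hi ∧ s'.reg u = 1 ∧ I (s.reg i + 1) s' := by
      refine (hbody _ s le_rfl (by omega) rfl (fun _ _ => rfl) hI).seq fun s' hagree hI' =>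
        Reaches.of_wp_steps ?_
      simp only [wp, State.setReg_reg, Op.eval, if_true, if_neg hi_ne.1, if_neg hi_ne.2,
        hagree i (hwrites i (by simp)), hagree m (hwrites m (by simp)),
        hagree u (hwrites u (by simp)), hu]
      exact ⟨by omega, trivial, hm, trivial, hI'⟩
    refine (Reaches.loop_of_lt hi_lt hround fun s' hagree ⟨hi', hm', hu', hI'⟩ => ?_).mono
      (N := N + 1 + (rounds * (N + 2) + 1) + 1) (by rw [Nat.succ_mul]; omega) (fun _ => id) hs
    refine ih hm' hu' (by omega) (by rwa [hi']) (fun k s'' hk hk' hi'' hagree' hIk => ?_) (by omega)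
    exact hbody k s'' (by omega) hk' hi'' (hagree.trans hagree') hIk

end RAM

namespace Makespan

open Finset

/-! ### Optimal schedules close to a reference schedule -/

theorem exists_le_card_filter_eq {ι : Type*} {S : Finset ι} {a : ι → ℕ} {P : ℕ} (hP : 0 < P)
    (hS : P ^ 2 ≤ #S) (hpos : ∀ j ∈ S, 0 < a j) (hle : ∀ j ∈ S, a j ≤ P) :
    ∃ v, 0 < v ∧ v ≤ P ∧ P ≤ #{j ∈ S | a j = v} := by
  obtain ⟨v, hv, hcard⟩ := exists_le_card_fiber_of_mul_le_card_of_maps_to (t := Icc 1 P) (n := P)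
    (fun j hj => mem_Icc.2 ⟨hpos j hj, hle j hj⟩) ⟨1, mem_Icc.2 ⟨le_rfl, hP⟩⟩
    (by rwa [Nat.card_Icc, Nat.add_sub_cancel, ← sq])
  exact ⟨v, (mem_Icc.1 hv).1, (mem_Icc.1 hv).2, hcard⟩

theorem sum_le_sum_of_mul_le_mul {ι : Type*} {X Y : Finset ι} {b : ι → ℕ} {v w : ℕ} (hX : #X = v)
    (hY : #Y = w) (h : ∀ j ∈ Y, ∀ k ∈ X, v * b k ≤ w * b j) (hvw : 0 < v * w) :
    ∑ k ∈ X, b k ≤ ∑ j ∈ Y, b j := by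
  refine Nat.le_of_mul_le_mul_left ?_ hvw
  calc v * w * ∑ k ∈ X, b k = ∑ _j ∈ Y, ∑ k ∈ X, v * b k := by
        rw [sum_const, hY, ← mul_sum, smul_eq_mul]; ring
    _ ≤ ∑ j ∈ Y, ∑ _k ∈ X, w * b j := sum_le_sum fun j hj => sum_le_sum fun k hk => h j hj k hk
    _ = v * w * ∑ j ∈ Y, b j := by simp only [sum_const, hX, smul_eq_mul, ← mul_sum]; ring

section Proximity

variable {ι : Type*} [DecidableEq ι] {J G S X Y : Finset ι} {a b : ι → ℕ} {P : ℕ}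

/-- The makespan of the schedule of the jobs in `J` that puts the jobs in `S` on a machine with
times `a` and the remaining ones on a machine with times `b`. -/
def splitCost (J : Finset ι) (a b : ι → ℕ) (S : Finset ι) : ℕ :=
  max (∑ j ∈ S, a j) (∑ j ∈ J \ S, b j)

/-- `S` describes an optimal schedule of the jobs in `J` on the two machines of `splitCost`. -/
structure IsOptimalSplit (J : Finset ι) (a b : ι → ℕ) (S : Finset ι) : Prop where
  subset : S ⊆ J
  splitCost_le : ∀ T ⊆ J, splitCost J a b S ≤ splitCost J a b T

/-- An optimal schedule that differs from `G` in as few jobs as possible. -/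
structure IsNearestOptimal (J : Finset ι) (a b : ι → ℕ) (G S : Finset ι) : Prop
    extends IsOptimalSplit J a b S where
  card_le : ∀ T ⊆ J, splitCost J a b T ≤ splitCost J a b S → #(symmDiff G S) ≤ #(symmDiff G T)

theorem exists_isNearestOptimal (J : Finset ι) (a b : ι → ℕ) (G : Finset ι) :
    ∃ S, IsNearestOptimal J a b G S := by
  obtain ⟨S, hS, hmin⟩ := exists_min_image J.powerset
    (fun T => toLex (splitCost J a b T, #(symmDiff G T))) (powerset_nonempty J)
  simp only [Prod.Lex.toLex_le_toLex, mem_powerset] at hS hmin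
  exact ⟨S, ⟨hS, fun T hT => (hmin T hT).elim le_of_lt fun h => h.1.le⟩,
    fun T hT hle => (hmin T hT).elim (fun h => absurd hle h.not_ge) And.right⟩

/-- Swapping `X` for `Y` in `S` would give a schedule that is as good and closer to `G`. -/
theorem IsNearestOptimal.union_eq_empty_of_exchange (hS : IsNearestOptimal J a b G S) (hG : G ⊆ J)
    (hX : X ⊆ S \ G) (hY : Y ⊆ G \ S) (ha : ∑ j ∈ Y, a j ≤ ∑ j ∈ X, a j)
    (hb : ∑ j ∈ X, b j ≤ ∑ j ∈ Y, b j) : X ∪ Y = ∅ := by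
  have hXS : X ⊆ S := hX.trans sdiff_subset
  have hYS : Disjoint (S \ X) Y :=
    disjoint_left.2 fun j hj hjY => (mem_sdiff.1 (hY hjY)).2 (mem_sdiff.1 hj).1
  have hT : S \ X ∪ Y ⊆ J :=
    union_subset (sdiff_subset.trans hS.subset) ((hY.trans sdiff_subset).trans hG)
  have hsum (f : ι → ℕ) : ∑ j ∈ S \ X ∪ Y, f j + ∑ j ∈ X, f j = ∑ j ∈ S, f j + ∑ j ∈ Y, f j := by
    rw [sum_union hYS, add_right_comm, sum_sdiff hXS]
  have hcost : splitCost J a b (S \ X ∪ Y) ≤ splitCost J a b S := by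
    have hsum_a := hsum a
    have hsum_b := hsum b
    have hcompl_T := sum_sdiff (f := b) hT
    have hcompl_S := sum_sdiff (f := b) hS.subset
    exact max_le_max (by omega) (by omega)
  have hsymm : symmDiff G (S \ X ∪ Y) = symmDiff G S \ (X ∪ Y) := by
    ext j
    have hXj := @hX j
    have hYj := @hY j
    simp only [mem_symmDiff, mem_sdiff, mem_union] at hXj hYj ⊢
    tauto
  have hsub : X ∪ Y ⊆ symmDiff G S :=
    union_subset (hX.trans subset_union_right) (hY.trans subset_union_left)
  have hcard := hS.card_le _ hT hcost
  rw [hsymm, card_sdiff_of_subset hsub] at hcard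
  exact card_eq_zero.1 (by have := card_le_card hsub; omega)

theorem IsNearestOptimal.left_pos (hS : IsNearestOptimal J a b G S) (hG : G ⊆ J) {j : ι}
    (hj : j ∈ G \ S) : 0 < a j := by
  by_contra! ha
  simpa using hS.union_eq_empty_of_exchange hG (empty_subset _) (singleton_subset_iff.2 hj)
    (by simpa using ha) (by simp)

theorem IsNearestOptimal.right_pos (hS : IsNearestOptimal J a b G S) (hG : G ⊆ J) {k : ι}
    (hk : k ∈ S \ G) : 0 < b k := by
  by_contra! hb
  simpa using hS.union_eq_empty_of_exchange hG (singleton_subset_iff.2 hk) (empty_subset _)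
    (by simp) (by simpa using hb)

/-- A schedule that is almost balanced and in which the jobs are sorted by the ratio of their times:
`G` has the jobs on the machine with times `a`, and the gap between the loads is at most `2 * P`. -/
structure IsReference (J : Finset ι) (P : ℕ) (a b : ι → ℕ) (G : Finset ι) : Prop where
  subset : G ⊆ J
  left_pos : ∀ k ∈ J \ G, 0 < a k
  right_pos : ∀ j ∈ G, 0 < a j → 0 < b j
  cross_le : ∀ j ∈ G, ∀ k ∈ J \ G, a j * b k ≤ a k * b j
  right_le : ∑ j ∈ J \ G, b j ≤ ∑ j ∈ G, a j
  left_le : ∑ j ∈ G, a j ≤ ∑ j ∈ J \ G, b j + 2 * P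

/-- If both differences were large, one could exchange `w` jobs with time `v` for `v` jobs with time
`w`. -/
theorem IsNearestOptimal.card_sdiff_lt_or (hS : IsNearestOptimal J a b G S)
    (hG : IsReference J P a b G) (hP : 0 < P) (ha : ∀ j ∈ J, a j ≤ P) :
    #(G \ S) < P ^ 2 ∨ #(S \ G) < P ^ 2 := by
  by_contra! ⟨hGS, hSG⟩
  have hSGJ : S \ G ⊆ J \ G := sdiff_subset_sdiff hS.subset le_rfl
  obtain ⟨v, hv, hvP, hcard_v⟩ := exists_le_card_filter_eq hP hGS
    (fun j hj => hS.left_pos hG.subset hj) (fun j hj => ha j (hG.subset (sdiff_subset hj)))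
  obtain ⟨w, hw, hwP, hcard_w⟩ := exists_le_card_filter_eq hP hSG
    (fun k hk => hG.left_pos k (hSGJ hk)) (fun k hk => ha k (hS.subset (sdiff_subset hk)))
  obtain ⟨Y, hY, hcard_Y⟩ := exists_subset_card_eq (hwP.trans hcard_v)
  obtain ⟨X, hX, hcard_X⟩ := exists_subset_card_eq (hvP.trans hcard_w)
  have hYv : ∀ j ∈ Y, a j = v := fun j hj => (mem_filter.1 (hY hj)).2
  have hXw : ∀ k ∈ X, a k = w := fun k hk => (mem_filter.1 (hX hk)).2
  replace hY : Y ⊆ G \ S := hY.trans (filter_subset _ _)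
  replace hX : X ⊆ S \ G := hX.trans (filter_subset _ _)
  have hsum_a : ∑ j ∈ Y, a j = ∑ k ∈ X, a k := by
    rw [sum_congr rfl hYv, sum_congr rfl hXw, sum_const, sum_const, hcard_Y, hcard_X, smul_eq_mul,
      smul_eq_mul, mul_comm]
  have hsum_b : ∑ k ∈ X, b k ≤ ∑ j ∈ Y, b j := by
    refine sum_le_sum_of_mul_le_mul hcard_X hcard_Y (fun j hj k hk => ?_) (mul_pos hv hw)
    simpa only [hYv j hj, hXw k hk] using hG.cross_le j (sdiff_subset (hY hj)) k (hSGJ (hX hk))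
  have hempty := hS.union_eq_empty_of_exchange hG.subset hX hY hsum_a.le hsum_b
  rw [(Finset.union_eq_empty.1 hempty).2, card_empty] at hcard_Y
  omega

theorem sum_sdiff_add_eq (f : ι → ℕ) (S T : Finset ι) :
    ∑ j ∈ S, f j + ∑ j ∈ T \ S, f j = ∑ j ∈ T, f j + ∑ j ∈ S \ T, f j := by
  rw [← sum_inter_add_sum_sdiff S T, ← sum_inter_add_sum_sdiff T S, inter_comm]; ring

theorem IsReference.splitCost_eq (hG : IsReference J P a b G) :
    splitCost J a b G = ∑ j ∈ G, a j :=
  max_eq_left hG.right_le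

theorem IsNearestOptimal.sum_sdiff_le (hS : IsNearestOptimal J a b G S)
    (hG : IsReference J P a b G) :
    ∑ j ∈ S \ G, a j ≤ ∑ j ∈ G \ S, a j := by
  have hcost : ∑ j ∈ S, a j ≤ ∑ j ∈ G, a j :=
    (le_max_left _ _).trans ((hS.splitCost_le G hG.subset).trans_eq hG.splitCost_eq)
  have := sum_sdiff_add_eq a G S
  omega

theorem IsNearestOptimal.card_sdiff_le (hS : IsNearestOptimal J a b G S)
    (hG : IsReference J P a b G) :
    #(G \ S) ≤ ∑ j ∈ S \ G, b j + 2 * P := by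
  have hcost : ∑ j ∈ J \ S, b j ≤ ∑ j ∈ G, a j :=
    (le_max_right _ _).trans ((hS.splitCost_le G hG.subset).trans_eq hG.splitCost_eq)
  have hcard : #(G \ S) ≤ ∑ j ∈ G \ S, b j := by
    simpa using card_nsmul_le_sum (G \ S) b 1 fun j hj =>
      hG.right_pos j (sdiff_subset hj) (hS.left_pos hG.subset hj)
  have hcompl_G := sum_sdiff (f := b) hG.subset
  have hcompl_S := sum_sdiff (f := b) hS.subset
  have hsymm := sum_sdiff_add_eq b G S
  have hgap := hG.left_le
  omega

theorem IsNearestOptimal.sum_sdiff_le_pow (hS : IsNearestOptimal J a b G S)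
    (hG : IsReference J P a b G) (ha : ∀ j ∈ J, a j ≤ P) (hb : ∀ j ∈ J, b j ≤ P) :
    ∑ j ∈ G \ S, a j ≤ 3 * P ^ 4 := by
  have hsum_a : ∑ j ∈ G \ S, a j ≤ #(G \ S) * P :=
    sum_le_card_nsmul _ _ _ fun j hj => ha j (hG.subset (sdiff_subset hj))
  have hsum_b : ∑ j ∈ S \ G, b j ≤ #(S \ G) * P :=
    sum_le_card_nsmul _ _ _ fun j hj => hb j (hS.subset (sdiff_subset hj))
  have hcard := hS.card_sdiff_le hG
  obtain rfl | hP := P.eq_zero_or_pos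
  · omega
  have hcard' : #(G \ S) ≤ 3 * P ^ 3 := by
    obtain h | h := hS.card_sdiff_lt_or hG hP ha
    · nlinarith [Nat.pow_le_pow_right hP (show 2 ≤ 3 by norm_num)]
    · nlinarith [Nat.pow_le_pow_right hP (show 1 ≤ 3 by norm_num)]
  calc _ ≤ #(G \ S) * P := hsum_a
    _ ≤ 3 * P ^ 3 * P := Nat.mul_le_mul_right _ hcard'
    _ = 3 * P ^ 4 := by ring

end Proximity

/-! ### Sorting by rounded ratios -/

section Greedy

variable {n P r i j k : ℕ} {a b : ℕ → ℕ} {G : Finset ℕ}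

/-- The ratio of the two times of a job, rounded down to a multiple of `1 / P ^ 2`. It is `0` if the
time on the second machine is `0`. -/
def ratio (P : ℕ) (a b : ℕ → ℕ) (j : ℕ) : ℕ := a j * P ^ 2 / b j

theorem ratio_pos (ha : 0 < a j) (hb : 0 < b j) (hbP : b j ≤ P) : 0 < ratio P a b j :=
  Nat.div_pos (by nlinarith) hb

theorem ratio_le (haP : a j ≤ P) : ratio P a b j ≤ P ^ 3 :=
  (Nat.div_le_self _ _).trans (by rw [pow_succ' P 2]; exact Nat.mul_le_mul_right _ haP)

theorem left_pos_of_ratio_pos (h : 0 < ratio P a b j) : 0 < a j := by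
  rw [Nat.pos_iff_ne_zero]
  rintro ha
  simp [ratio, ha] at h

/-- Two different fractions with denominators at most `P` differ by at least `1 / P ^ 2`. -/
theorem ratio_lt_ratio (hj : 0 < b j) (hjP : b j ≤ P) (hk : 0 < b k) (hkP : b k ≤ P)
    (h : a k * b j < a j * b k) : ratio P a b k < ratio P a b j := by
  refine (Nat.le_div_iff_mul_le hj).2 (Nat.le_of_mul_le_mul_left ?_ hk)
  calc b k * ((ratio P a b k + 1) * b j) = (ratio P a b k * b k + b k) * b j := by ring
    _ ≤ (a k * P ^ 2 + b k) * b j :=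
      Nat.mul_le_mul_right _ (Nat.add_le_add_right (Nat.div_mul_le_self _ _) _)
    _ = a k * b j * P ^ 2 + b k * b j := by ring
    _ ≤ a k * b j * P ^ 2 + P * P := by gcongr
    _ = (a k * b j + 1) * P ^ 2 := by ring
    _ ≤ a j * b k * P ^ 2 := by gcongr; exact h
    _ = b k * (a j * P ^ 2) := by ring

/-- The jobs `j < n` that need no time on the first machine, or whose pair `(ratio P a b j, j)`
comes before `(r, i)` in the lexicographic order. Jobs with ratio `0` need no time on the second
machine and are left out. -/
def ratioPrefix (n P : ℕ) (a b : ℕ → ℕ) (r i : ℕ) : Finset ℕ :=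
  {j ∈ range n | a j = 0 ∨
    0 < ratio P a b j ∧ (ratio P a b j < r ∨ ratio P a b j = r ∧ j < i)}

theorem mem_ratioPrefix : j ∈ ratioPrefix n P a b r i ↔ j < n ∧ (a j = 0 ∨
    0 < ratio P a b j ∧ (ratio P a b j < r ∨ ratio P a b j = r ∧ j < i)) := by
  rw [ratioPrefix, mem_filter, mem_range]

theorem ratioPrefix_one_zero : ratioPrefix n P a b 1 0 = {j ∈ range n | a j = 0} := by
  ext j
  rw [mem_ratioPrefix, mem_filter, mem_range]
  exact and_congr_right fun _ => or_iff_left (by omega)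

theorem ratioPrefix_succ_left : ratioPrefix n P a b (r + 1) 0 = ratioPrefix n P a b r n := by
  ext j
  simp only [mem_ratioPrefix]
  exact and_congr_right fun _ => or_congr_right (by omega)

theorem ratioPrefix_succ_right_of_ne (h : ratio P a b i ≠ r) :
    ratioPrefix n P a b r (i + 1) = ratioPrefix n P a b r i := by
  ext j
  simp only [mem_ratioPrefix]
  refine and_congr_right fun _ => or_congr_right (and_congr_right fun _ => or_congr_right
    (and_congr_right fun hj => ?_))
  have : j ≠ i := fun hji => h (hji ▸ hj)
  omega

theorem ratioPrefix_succ_right (hi : i < n) (hr : 0 < r) (h : ratio P a b i = r) :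
    ratioPrefix n P a b r (i + 1) = insert i (ratioPrefix n P a b r i) := by
  ext j
  simp only [mem_ratioPrefix, mem_insert]
  obtain rfl | hji := eq_or_ne j i
  · simp only [hi, hr, h, Nat.lt_succ_self, and_self, or_true, true_or]
  · rw [or_iff_right hji]
    refine and_congr_right fun _ => or_congr_right (and_congr_right fun _ => or_congr_right
      (and_congr_right fun _ => ?_))
    omega

/-- The greedy schedule after all pairs before `(r, i)` have been considered: a job with ratio `r`
is moved to the first machine while that machine has the smaller load. -/
structure IsGreedy (n P : ℕ) (a b : ℕ → ℕ) (r i : ℕ) (G : Finset ℕ) : Prop where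
  eq_ratioPrefix : ∃ r' i', G = ratioPrefix n P a b r' i'
  left_le : ∑ j ∈ G, a j ≤ ∑ j ∈ range n \ G, b j + 2 * P
  right_le_or : ∑ j ∈ range n \ G, b j ≤ ∑ j ∈ G, a j ∨ G = ratioPrefix n P a b r i

theorem isGreedy_one_zero (n P : ℕ) (a b : ℕ → ℕ) :
    IsGreedy n P a b 1 0 {j ∈ range n | a j = 0} where
  eq_ratioPrefix := ⟨1, 0, ratioPrefix_one_zero.symm⟩
  left_le := by rw [sum_eq_zero fun j hj => (mem_filter.1 hj).2]; exact Nat.zero_le _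
  right_le_or := .inr ratioPrefix_one_zero.symm

theorem IsGreedy.subset (hG : IsGreedy n P a b r i G) : G ⊆ range n := by
  obtain ⟨r', i', rfl⟩ := hG.eq_ratioPrefix
  exact filter_subset _ _

theorem IsGreedy.succ_left (hG : IsGreedy n P a b r n G) : IsGreedy n P a b (r + 1) 0 G :=
  ⟨hG.eq_ratioPrefix, hG.left_le, ratioPrefix_succ_left ▸ hG.right_le_or⟩

theorem IsGreedy.succ_right_of_not (hG : IsGreedy n P a b r i G)
    (h : ¬(ratio P a b i = r ∧ ∑ j ∈ G, a j < ∑ j ∈ range n \ G, b j)) :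
    IsGreedy n P a b r (i + 1) G := by
  refine ⟨hG.eq_ratioPrefix, hG.left_le, ?_⟩
  by_cases hr : ratio P a b i = r
  · exact .inl (not_lt.1 fun hlt => h ⟨hr, hlt⟩)
  · exact ratioPrefix_succ_right_of_ne hr ▸ hG.right_le_or

section Move

variable (hG : IsGreedy n P a b r i G) (hlt : ∑ j ∈ G, a j < ∑ j ∈ range n \ G, b j)

include hG hlt

theorem IsGreedy.eq_of_lt : G = ratioPrefix n P a b r i := hG.right_le_or.resolve_left hlt.not_ge

theorem IsGreedy.notMem (hr : 0 < r) (h : ratio P a b i = r) : i ∉ G := by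
  rw [hG.eq_of_lt hlt, mem_ratioPrefix]
  have := left_pos_of_ratio_pos (h ▸ hr)
  omega

theorem IsGreedy.move (hi : i < n) (hr : 0 < r) (h : ratio P a b i = r) (ha : a i ≤ P)
    (hb : b i ≤ P) : IsGreedy n P a b r (i + 1) (insert i G) := by
  have heq : insert i G = ratioPrefix n P a b r (i + 1) := by
    rw [ratioPrefix_succ_right hi hr h, ← hG.eq_of_lt hlt]
  refine ⟨⟨_, _, heq⟩, ?_, .inr heq⟩
  have hiG := hG.notMem hlt hr h
  have hcompl := add_sum_erase (range n \ G) b (mem_sdiff.2 ⟨mem_range.2 hi, hiG⟩)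
  rw [sum_insert hiG, sdiff_insert]
  omega

end Move

theorem IsGreedy.isReference (hG : IsGreedy n P a b (P ^ 3 + 1) 0 G) (ha : ∀ j < n, a j ≤ P)
    (hb : ∀ j < n, b j ≤ P) : IsReference (range n) P a b G where
  subset := hG.subset
  left_le := hG.left_le
  left_pos k hk := by
    obtain ⟨r, i, rfl⟩ := hG.eq_ratioPrefix
    rw [mem_sdiff, mem_ratioPrefix, mem_range] at hk
    omega
  right_pos j hj haj := by
    obtain ⟨r, i, rfl⟩ := hG.eq_ratioPrefix
    rw [Nat.pos_iff_ne_zero]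
    rintro hbj
    simp [mem_ratioPrefix, ratio, hbj, haj.ne'] at hj
  cross_le j hj k hk := by
    obtain ⟨r, i, rfl⟩ := hG.eq_ratioPrefix
    rw [mem_sdiff, mem_range] at hk
    simp only [mem_ratioPrefix] at hj hk
    by_contra! hlt
    obtain ⟨haj, hbk⟩ := CanonicallyOrderedAdd.mul_pos.1 (pos_of_gt hlt)
    have hbj : 0 < b j := by
      rw [Nat.pos_iff_ne_zero]
      rintro hbj
      have : ratio P a b j = 0 := by rw [ratio, hbj, Nat.div_zero]
      omega
    have hrk : a k ≠ 0 → 0 < ratio P a b k := fun hak =>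
      ratio_pos (Nat.pos_of_ne_zero hak) hbk (hb k hk.1)
    have := ratio_lt_ratio hbj (hb j hj.1) hbk (hb k hk.1) hlt
    omega
  right_le := by
    obtain h | rfl := hG.right_le_or
    · exact h
    · rw [sum_eq_zero]
      · exact Nat.zero_le _
      · intro j hj
        rw [mem_sdiff, mem_range, mem_ratioPrefix] at hj
        by_contra hbj
        have := ratio_le (b := b) (ha j hj.1)
        have := fun haj => ratio_pos (j := j) (a := a) haj (Nat.pos_of_ne_zero hbj) (hb j hj.1)
        omega

end Greedy

/-! ### The dynamic program -/

section Table

variable (a b c : ℕ → ℕ) (Q D : ℕ)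

/-- The function that agrees with `f` on `S` and vanishes elsewhere. -/
def restrict (f : ℕ → ℕ) (S : Finset ℕ) (j : ℕ) : ℕ := if j ∈ S then f j else 0

theorem restrict_le (f : ℕ → ℕ) (S : Finset ℕ) (j : ℕ) : restrict f S j ≤ f j := by
  rw [restrict]
  split_ifs <;> simp only [le_refl, zero_le]

theorem sum_restrict (f : ℕ → ℕ) {S T : Finset ℕ} (hS : S ⊆ T) :
    ∑ j ∈ T, restrict f S j = ∑ j ∈ S, f j := by
  simp only [restrict]
  rw [sum_ite_mem, inter_eq_right.2 hS]

theorem sum_restrict_le_add (f : ℕ → ℕ) (R S T : Finset ℕ) :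
    ∑ j ∈ R, restrict f S j ≤ ∑ j ∈ R, restrict f T j + ∑ j ∈ S \ T, f j :=
  calc ∑ j ∈ R, restrict f S j ≤ ∑ j ∈ R, (restrict f T j + restrict f (S \ T) j) := by
        refine sum_le_sum fun j _ => ?_
        simp only [restrict, mem_sdiff]
        split_ifs <;> first | omega | tauto
    _ ≤ ∑ j ∈ R, restrict f T j + ∑ j ∈ S \ T, f j := by
        rw [sum_add_distrib]
        simp only [restrict]
        rw [sum_ite_mem R (S \ T)]
        exact Nat.add_le_add_left (sum_le_sum_of_subset inter_subset_right) _

/-- The table of the dynamic program for the schedules that stay close to prescribed loads `c j` on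
the first machine. The entry at `x` in row `k` is about the schedules of the first `k` jobs with
load `x + ∑ j ∈ range k, c j - 4 * Q` on that machine: it is `D` plus the time that one of them
saves on the second machine, and at least as large as for those whose loads on all prefixes deviate
from `c` by at most `3 * Q`. A `D` above the total saving distinguishes such entries from those that
no schedule attains. -/
def table : ℕ → ℕ → ℕ
  | 0, x => if x = 4 * Q then D else 0
  | k + 1, x =>
    if Q ≤ x ∧ x < 8 * Q then max (table k (x + c k)) (table k (x + c k - a k) + b k) else 0

/-- Whether an optimal schedule for `table a b c Q D (k + 1) x` may have job `k` on the first
machine. -/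
def Takes (k x : ℕ) : Prop :=
  table a b c Q D k (x + c k) ≤ table a b c Q D k (x + c k - a k) + b k

instance (k x : ℕ) : Decidable (Takes a b c Q D k x) := inferInstanceAs (Decidable (_ ≤ _))

/-- The entry of row `k` from which the one at `x` in row `k + 1` is obtained. -/
def source (k x : ℕ) : ℕ := if Takes a b c Q D k x then x + c k - a k else x + c k

/-- The jobs on the first machine in a schedule that attains `table a b c Q D k x`. -/
def choice : ℕ → ℕ → Finset ℕ
  | 0, _ => ∅
  | k + 1, x =>
    if Takes a b c Q D k x then insert k (choice k (source a b c Q D k x))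
    else choice k (source a b c Q D k x)

variable {a b c Q D} {k x : ℕ}

theorem table_le (k x : ℕ) : table a b c Q D k x ≤ D + ∑ j ∈ range k, b j := by
  induction k generalizing x with
  | zero => rw [table]; split_ifs <;> omega
  | succ k ih =>
    rw [table, sum_range_succ]
    have := ih (x + c k)
    have := ih (x + c k - a k)
    split_ifs <;> omega

theorem le_table {S : Finset ℕ}
    (hdev : ∀ i ≤ k, ∑ j ∈ range i, c j ≤ ∑ j ∈ range i, restrict a S j + 3 * Q ∧
      ∑ j ∈ range i, restrict a S j ≤ ∑ j ∈ range i, c j + 3 * Q)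
    (hQ : 0 < Q) (hx : x + ∑ j ∈ range k, c j = 4 * Q + ∑ j ∈ range k, restrict a S j) :
    D + ∑ j ∈ range k, restrict b S j ≤ table a b c Q D k x := by
  induction k generalizing x with
  | zero =>
    simp only [range_zero, sum_empty, add_zero] at hx ⊢
    rw [table, if_pos hx]
  | succ k ih =>
    have hk := hdev k (by omega)
    have hk' := hdev (k + 1) le_rfl
    specialize @ih (x + c k - restrict a S k) fun i hi => hdev i (by omega)
    simp only [sum_range_succ] at hk' hx ⊢
    have hrange : Q ≤ x ∧ x < 8 * Q := by omega
    rw [table, if_pos hrange, ← add_assoc]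
    specialize ih (by omega)
    by_cases hkS : k ∈ S
    · rw [restrict, if_pos hkS] at ih ⊢
      exact le_max_of_le_right (Nat.add_le_add_right ih _)
    · rw [restrict, if_neg hkS] at ih ⊢
      exact le_max_of_le_left ih

theorem table_source_of_lt (hx : ∑ j ∈ range (k + 1), b j < table a b c Q D (k + 1) x) :
    Q ≤ x ∧ x < 8 * Q ∧ ∑ j ∈ range k, b j < table a b c Q D k (source a b c Q D k x) ∧
      table a b c Q D (k + 1) x =
        table a b c Q D k (source a b c Q D k x) + if Takes a b c Q D k x then b k else 0 := by
  rw [table, sum_range_succ] at hx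
  rw [table]
  split at hx
  case isFalse => omega
  case isTrue hrange =>
    rw [if_pos hrange, source]
    refine ⟨hrange.1, hrange.2, ?_⟩
    split_ifs with htake <;> rw [Takes] at htake <;> omega

theorem choice_subset (k x : ℕ) : choice a b c Q D k x ⊆ range k := by
  induction k generalizing x with
  | zero => exact empty_subset _
  | succ k ih =>
    rw [choice, range_add_one]
    split
    · exact insert_subset_insert k (ih _)
    · exact (ih _).trans (subset_insert _ _)

theorem self_mem_choice_succ : k ∈ choice a b c Q D (k + 1) x ↔ Takes a b c Q D k x := by
  have hk : k ∉ choice a b c Q D k (source a b c Q D k x) :=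
    fun hk => notMem_range_self (choice_subset _ _ hk)
  rw [choice]
  split_ifs with htake <;> simp [htake, hk]

theorem mem_choice_succ_of_lt {j : ℕ} (hj : j < k) :
    j ∈ choice a b c Q D (k + 1) x ↔ j ∈ choice a b c Q D k (source a b c Q D k x) := by
  rw [choice]
  split_ifs
  · rw [mem_insert, or_iff_right hj.ne]
  · rfl

theorem sum_choice (ha : ∀ j < k, a j ≤ Q) (hx : ∑ j ∈ range k, b j < table a b c Q D k x) :
    x + ∑ j ∈ range k, c j = 4 * Q + ∑ j ∈ choice a b c Q D k x, a j ∧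
      table a b c Q D k x = D + ∑ j ∈ choice a b c Q D k x, b j := by
  induction k generalizing x with
  | zero =>
    rw [table] at hx ⊢
    split at hx
    · simp_all [choice]
    · omega
  | succ k ih =>
    have hak := ha k k.lt_succ_self
    obtain ⟨hQx, -, hlt, heq⟩ := table_source_of_lt hx
    obtain ⟨hleft, hright⟩ := ih (fun j hj => ha j (by omega)) hlt
    rw [heq, hright, choice, sum_range_succ]
    have hk : k ∉ choice a b c Q D k (source a b c Q D k x) :=
      fun hk => notMem_range_self (choice_subset _ _ hk)
    have hsource : source a b c Q D k x + (if Takes a b c Q D k x then a k else 0) = x + c k := by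
      rw [source]
      split_ifs <;> omega
    split_ifs at hsource ⊢
    · rw [sum_insert hk, sum_insert hk]
      omega
    · omega

end Table

section Optimality

variable {a b : ℕ → ℕ} {G : Finset ℕ} {n P Q x : ℕ}

/-- The table for the deviations from the schedule `G`. The offset exceeds the total time on the
second machine. -/
def savings (n : ℕ) (a b : ℕ → ℕ) (G : Finset ℕ) (Q : ℕ) : ℕ → ℕ → ℕ :=
  table a b (restrict a G) Q (∑ j ∈ range n, b j + 1)

/-- The makespan that an entry of the final row stands for, which is larger than
`∑ j ∈ range n, b j` if the entry does not belong to a schedule. -/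
def rowCost (n : ℕ) (a b : ℕ → ℕ) (G : Finset ℕ) (Q x : ℕ) : ℕ :=
  max (∑ j ∈ range n, restrict a G j + x - 4 * Q)
    (2 * ∑ j ∈ range n, b j + 1 - savings n a b G Q n x)

/-- The jobs on the first machine in the schedule that an entry of the final row stands for. -/
def rowChoice (n : ℕ) (a b : ℕ → ℕ) (G : Finset ℕ) (Q x : ℕ) : Finset ℕ :=
  choice a b (restrict a G) Q (∑ j ∈ range n, b j + 1) n x

theorem sum_lt_savings (hx : rowCost n a b G Q x ≤ ∑ j ∈ range n, b j) :
    ∑ j ∈ range n, b j < savings n a b G Q n x := by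
  rw [rowCost] at hx
  omega

theorem rowChoice_subset : rowChoice n a b G Q x ⊆ range n := choice_subset n x

theorem splitCost_rowChoice (ha : ∀ j < n, a j ≤ Q)
    (hx : rowCost n a b G Q x ≤ ∑ j ∈ range n, b j) :
    splitCost (range n) a b (rowChoice n a b G Q x) = rowCost n a b G Q x := by
  obtain ⟨hleft, hright⟩ := sum_choice ha (sum_lt_savings hx)
  have hcompl := sum_sdiff (f := b) (rowChoice_subset (n := n) (a := a) (b := b) (G := G) (Q := Q)
    (x := x))
  rw [splitCost, rowCost, savings]
  rw [← rowChoice] at hleft hright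
  omega

theorem exists_rowCost_le (hG : IsReference (range n) P a b G) (hP : 0 < P)
    (ha : ∀ j < n, a j ≤ P) (hb : ∀ j < n, b j ≤ P) :
    ∃ x, P ^ 4 ≤ x ∧ x < 8 * P ^ 4 ∧ ∀ T ⊆ range n,
      rowCost n a b G (P ^ 4) x ≤ splitCost (range n) a b T := by
  obtain ⟨S, hS⟩ := exists_isNearestOptimal (range n) a b G
  have hGS := hS.sum_sdiff_le_pow hG (fun j hj => ha j (mem_range.1 hj))
    fun j hj => hb j (mem_range.1 hj)
  have hSG := (hS.sum_sdiff_le hG).trans hGS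
  have hdev (i : ℕ) (_ : i ≤ n) :=
    And.intro ((sum_restrict_le_add a (range i) G S).trans (Nat.add_le_add_left hGS _))
      ((sum_restrict_le_add a (range i) S G).trans (Nat.add_le_add_left hSG _))
  have hn := hdev n le_rfl
  have hQ : 0 < P ^ 4 := pow_pos hP 4
  obtain ⟨x, hx⟩ := Nat.exists_eq_add_of_le' (show ∑ j ∈ range n, restrict a G j ≤
    4 * P ^ 4 + ∑ j ∈ range n, restrict a S j by omega)
  refine ⟨x, by omega, by omega, fun T hT => le_trans ?_ (hS.splitCost_le T hT)⟩
  have hrow := le_table (b := b) (D := ∑ j ∈ range n, b j + 1) hdev hQ hx.symm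
  have hcompl := sum_sdiff (f := b) hS.subset
  rw [sum_restrict b hS.subset] at hrow
  rw [sum_restrict a hS.subset] at hx
  rw [rowCost, splitCost, savings]
  omega

end Optimality

open RAM

/-! ### Memory layout -/

/-- The cells from `base` to `base + n - 1` hold the values of `f`. -/
def IsArray (base n : ℕ) (f : ℕ → ℕ) (m : ℕ → ℕ) : Prop := ∀ j < n, m (base + j) = f j

/-- The cells from `base` on hold, in rows of `w` cells, the entries of `T` that come before
`(k, y)` in the lexicographic order, and zeros in place of the others. -/
def IsTable (base w : ℕ) (T : ℕ → ℕ → ℕ) (k y : ℕ) (m : ℕ → ℕ) : Prop :=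
  ∀ i x, x < w → m (base + (i * w + x)) = if i < k ∨ i = k ∧ x < y then T i x else 0

/-- The input for jobs with times `a` and `b`, as in `inputState`. -/
def IsInput (n : ℕ) (a b : ℕ → ℕ) (m : ℕ → ℕ) : Prop :=
  ∀ j < n, m (j + j) = a j ∧ m (j + j + 1) = b j

section Memory

variable {base n w k y v x : ℕ} {a b f g m : ℕ → ℕ} {T : ℕ → ℕ → ℕ}

theorem IsArray.update (h : IsArray base n f m) (hfg : ∀ j < n, j ≠ x → g j = f j) (hx : g x = v) :
    IsArray base n g (Function.update m (base + x) v) := by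
  intro j hj
  rw [Function.update_apply]
  split_ifs with hjx
  · rw [← hx, Nat.add_left_cancel hjx]
  · rw [h j hj, hfg j hj fun hjx' => hjx (by rw [hjx'])]

theorem IsArray.update_of_lt (h : IsArray base n f m) (hx : x < base) :
    IsArray base n f (Function.update m x v) := fun j hj => by
  rw [Function.update_of_ne (by omega), h j hj]

theorem IsArray.update_of_le (h : IsArray base n f m) (hx : base + n ≤ x) :
    IsArray base n f (Function.update m x v) := fun j hj => by
  rw [Function.update_of_ne (by omega), h j hj]

theorem IsInput.update (h : IsInput n a b m) (hx : 2 * n ≤ x) :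
    IsInput n a b (Function.update m x v) := fun j hj => by
  rw [Function.update_of_ne (by omega), Function.update_of_ne (by omega)]
  exact h j hj

theorem IsTable.update_of_lt (h : IsTable base w T k y m) (hx : x < base) :
    IsTable base w T k y (Function.update m x v) := fun i z hz => by
  rw [Function.update_of_ne (by omega), h i z hz]

theorem IsTable.update (h : IsTable base w T k y m) (hy : y < w) (hv : v = T k y) :
    IsTable base w T k (y + 1) (Function.update m (base + (k * w + y)) v) := by
  intro i x hx
  have hinj : i * w + x = k * w + y ↔ i = k ∧ x = y := by
    refine ⟨fun heq => ?_, fun ⟨hik, hxy⟩ => by rw [hik, hxy]⟩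
    have hdiv := congrArg (· / w) heq
    simp only [Nat.mul_comm _ w, Nat.mul_add_div (pos_of_gt hx), Nat.div_eq_of_lt hx,
      Nat.div_eq_of_lt hy, add_zero] at hdiv
    exact ⟨hdiv, by rw [hdiv] at heq; omega⟩
  simp only [Function.update_apply, Nat.add_left_cancel_iff, hinj, h i x hx]
  grind

theorem IsTable.get (h : IsTable base w T k y m) {i : ℕ} (hi : i < k) (hx : x < w) :
    m (base + (i * w + x)) = T i x := by
  rw [h i x hx, if_pos (.inl hi)]

theorem IsTable.mono_of_eq_zero (h : IsTable base w T k y m) {l z : ℕ}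
    (hle : k < l ∨ k = l ∧ y ≤ z) (hT : ∀ i x, x < w → ¬(i < k ∨ i = k ∧ x < y) →
      (i < l ∨ i = l ∧ x < z) → T i x = 0) : IsTable base w T l z m := by
  intro i x hx
  rw [h i x hx]
  specialize hT i x hx
  split_ifs <;> grind

end Memory

/-! ### The program -/

/-- The registers of the program. The first one is register `0`, which holds the number of jobs at
the start and the makespan at the end. -/
inductive Reg where
  | jobs | zero | one | maxTime | total | left | right
  | twice | square | last | low | mid | top | width
  | job | level | quot | row | next | entry | arg | best | steps
  | time₀ | time₁ | offset | tmp | val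
  deriving DecidableEq

/-- The number of a register. -/
def Reg.code (x : Reg) : ℕ := x.ctorIdx

instance : CoeOut Reg ℕ := ⟨Reg.code⟩

theorem Reg.code_inj {x y : Reg} : x.code = y.code ↔ x = y :=
  ⟨fun h => by rw [← Reg.ofNat_ctorIdx x, ← Reg.ofNat_ctorIdx y]; exact congrArg Reg.ofNat h,
    congrArg _⟩

theorem setReg_reg_code (s : State) (x y : Reg) (v : ℕ) :
    (s.setReg x v).reg y = if y = x then v else s.reg y := by
  simp only [State.setReg_reg, Reg.code_inj]

section Program

open Reg

/-- `x := y` -/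
def move (x y : Reg) : Program := .arith .add x y zero

/-- `x := max x y` -/
def raise (x y : Reg) : Program :=
  .block [.arith .sub tmp y x, .arith .add x x tmp]

/-- `x := mem[y + z]` -/
def fetch (x y z : Reg) : Program := .block [.arith .add tmp y z, .load x tmp]

/-- `mem[y + z] := x` -/
def put (x y z : Reg) : Program := .block [.arith .add tmp y z, .store tmp x]

/-- Read the times of the current job. -/
def fetchTimes : Program :=
  .block [fetch time₀ job job, .arith .add tmp tmp one, .load time₁ tmp]

/-- Sum up and maximize the times, with the jobs that need time on the first machine placed on the
second. -/
def scan : Program :=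
  .forLoop job jobs one <| .block [
    fetchTimes,
    raise maxTime time₀,
    raise maxTime time₁,
    .arith .add total total time₁,
    .ite zero time₀ (.arith .add right right time₁) .skip]

/-- Compute the powers of the largest time and the sizes of the regions of the memory. -/
def prepare : Program :=
  .block [
    .arith .mul square maxTime maxTime,
    .arith .mul last square maxTime,
    .arith .add last last one,
    .arith .mul low square square,
    .const tmp 4,
    .arith .mul mid tmp low,
    .arith .add top mid mid,
    .arith .add width top low,
    .arith .add twice jobs jobs]

/-- Move the current job to the first machine, and record its time there, if its ratio is `level`
and the first machine has the smaller load. -/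
def greedyStep : Program :=
  .block [
    fetchTimes,
    .arith .mul quot time₀ square,
    .arith .div quot quot time₁,
    .ite quot level .skip <| .ite level quot .skip <| .ite left right
      (.block [.arith .add left left time₀, .arith .sub right right time₁, put time₀ twice job])
      .skip]

/-- Run through the jobs for one ratio after the other. -/
def greedy : Program :=
  .block [
    move level one,
    .forLoop level last one <| .block [move job zero, .forLoop job jobs one greedyStep]]

/-- Read the data of the current job for the dynamic program. -/
def fetchJob : Program := .block [fetchTimes, fetch offset twice job]

/-- Read the two entries of the current row from which `entry` of the next row is computed, and add
the time of the job on the second machine to the latter. -/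
def fetchSources (x : Reg) : Program :=
  .block [
    .arith .add tmp row x,
    .arith .add tmp tmp offset,
    .load val tmp,
    .arith .sub tmp tmp time₀,
    .load quot tmp,
    .arith .add quot quot time₁]

/-- Compute an entry of the next row. -/
def fillEntry : Program := .block [fetchSources entry, raise val quot, put val next entry]

/-- Compute the next row and move on to it. -/
def fillRow : Program :=
  .block [
    .block [fetchJob, .arith .add next row width, move entry low],
    .forLoop entry top one fillEntry,
    move row next]

/-- Compute the table row by row. -/
def fillTable : Program :=
  .block [
    .block [
      .arith .add row twice jobs,
      .arith .add val total one,
      put val row mid,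
      move job zero],
    .forLoop job jobs one fillRow]

/-- Compute the makespan that an entry of the last row stands for, and compare it to the smallest
one so far. -/
def selectEntry : Program :=
  .block [
    fetch quot row entry,
    .arith .add val total total,
    .arith .add val val one,
    .arith .sub val val quot,
    .arith .add quot left entry,
    .arith .sub quot quot mid,
    raise val quot,
    .ite val best (.block [move best val, move arg entry]) .skip]

/-- Find the entry of the last row that stands for the smallest makespan. -/
def select : Program :=
  .block [
    .block [.arith .add best total one, move entry low],
    .forLoop entry top one selectEntry]

/-- Go back from the entry `arg` of the row after the current job to the entry of the row before
from which it was obtained, and record the machine of the job. -/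
def followEntry : Program :=
  .block [
    .arith .add arg arg offset,
    .ite quot val (put one twice job) (.block [put zero twice job, .arith .sub arg arg time₀])]

/-- Go back by one job, and decide on its machine. -/
def traceStep : Program :=
  .block [
    .block [.arith .sub job jobs steps, .arith .sub job job one, .arith .sub row row width],
    fetchJob,
    fetchSources arg,
    followEntry]

/-- Follow the entries of the table back to the first row, and record the machine of each job. -/
def trace : Program := .block [move steps zero, .forLoop steps jobs one traceStep]

/-- Copy the machines of the jobs to the place where the output is expected. -/
def copyOut : Program :=
  .block [
    move job zero,
    .forLoop job jobs one (.block [fetch val twice job, put val job zero])]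

/-- Read the input and compute the constants. -/
def setup : Program := .block [.block [.const one 1, .const maxTime 1], scan, prepare]

/-- Find the smallest makespan. -/
def search : Program := .block [fillTable, select]

/-- Output the optimal schedule and its makespan. -/
def output : Program := .block [trace, copyOut, move jobs best]

/-- The program for the two-machine problem. -/
def solver : Program := .block [setup, greedy, search, output]

end Program

/-! ### Correctness of the phases -/

/-- The times of `n` jobs are at most `P`, and `B` is large enough for the numbers that the program
computes from them. -/
structure Fits (B n P : ℕ) (a b : ℕ → ℕ) : Prop where
  pos : 0 < P
  left_le : ∀ j < n, a j ≤ P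
  right_le : ∀ j < n, b j ≤ P
  bound : 32 * (n * P ^ 4 + P ^ 4) ≤ B

theorem sum_le_mul_pow {n P : ℕ} {S : Finset ℕ} (hS : S ⊆ range n) {f : ℕ → ℕ}
    (hf : ∀ j < n, f j ≤ P) : ∑ j ∈ S, f j ≤ n * P ^ 4 :=
  calc ∑ j ∈ S, f j ≤ ∑ j ∈ range n, f j := sum_le_sum_of_subset hS
    _ ≤ #(range n) • P ^ 4 := sum_le_card_nsmul _ _ _ fun j hj =>
        (hf j (mem_range.1 hj)).trans (Nat.le_self_pow (by omega) P)
    _ = n * P ^ 4 := by rw [card_range, smul_eq_mul]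

theorem Fits.le_mul_pow {B n P : ℕ} {a b : ℕ → ℕ} (h : Fits B n P a b) : n ≤ n * P ^ 4 :=
  Nat.le_mul_of_pos_right n (Nat.pow_pos h.pos)

section Phases

open Reg

variable {B n P : ℕ} {a b : ℕ → ℕ} {s : State}

/-- The registers that are not changed after their initialization, except for `jobs`, which is
overwritten at the very end. -/
def constRegs : List Reg := [jobs, zero, one, total, twice, square, last, low, mid, top, width]

/-- The registers in `constRegs` have their intended values. -/
structure HasConstants (n P : ℕ) (b : ℕ → ℕ) (s : State) : Prop where
  jobs : s.reg jobs = n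
  zero : s.reg zero = 0
  one : s.reg one = 1
  total : s.reg total = ∑ j ∈ range n, b j
  twice : s.reg twice = 2 * n
  square : s.reg square = P ^ 2
  last : s.reg last = P ^ 3 + 1
  low : s.reg low = P ^ 4
  mid : s.reg mid = 4 * P ^ 4
  top : s.reg top = 8 * P ^ 4
  width : s.reg width = 9 * P ^ 4

theorem HasConstants.of_agreeOff {l : List ℕ} {s' : State} (h : HasConstants n P b s)
    (hagree : s.AgreeOff l s') (hl : ∀ x ∈ constRegs, x.code ∉ l) : HasConstants n P b s' where
  jobs := (hagree _ (hl _ (by decide))).trans h.jobs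
  zero := (hagree _ (hl _ (by decide))).trans h.zero
  one := (hagree _ (hl _ (by decide))).trans h.one
  total := (hagree _ (hl _ (by decide))).trans h.total
  twice := (hagree _ (hl _ (by decide))).trans h.twice
  square := (hagree _ (hl _ (by decide))).trans h.square
  last := (hagree _ (hl _ (by decide))).trans h.last
  low := (hagree _ (hl _ (by decide))).trans h.low
  mid := (hagree _ (hl _ (by decide))).trans h.mid
  top := (hagree _ (hl _ (by decide))).trans h.top
  width := (hagree _ (hl _ (by decide))).trans h.width

theorem reaches_scan (hfit : Fits B n P a b) (hjobs : s.reg jobs = n) (hzero : s.reg zero = 0)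
    (hone : s.reg one = 1) (hmax : s.reg maxTime = 1) (htotal : s.reg total = 0)
    (hright : s.reg right = 0) (hjob : s.reg job = 0) (hinput : IsInput n a b s.mem) :
    Reaches B (n * 32 + 1) scan s fun s' => s'.mem = s.mem ∧
      s'.reg maxTime = (range n).sup (fun j => max (a j) (b j)) ⊔ 1 ∧
      s'.reg total = ∑ j ∈ range n, b j ∧ s'.reg right = ∑ j ∈ range n with ¬a j = 0, b j := by
  refine (Reaches.forLoop (N := 17) (I := fun k s' => s'.mem = s.mem ∧
      s'.reg maxTime = (range k).sup (fun j => max (a j) (b j)) ⊔ 1 ∧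
      s'.reg total = ∑ j ∈ range k, b j ∧ s'.reg right = ∑ j ∈ range k with ¬a j = 0, b j)
    (by decide) (by decide) hjob hjobs hone (by omega) ?_ ?_).mono (by omega) fun _ => id
  · simp [hmax, hright, htotal]
  · rintro k s' - hk hjob' hagree ⟨hmem, hmax', htotal', hright'⟩
    refine Reaches.of_wp (by decide) ?_
    obtain ⟨hak, hbk⟩ := hinput k hk
    have hone' := (hagree one (by decide)).trans hone
    have hzero' := (hagree zero (by decide)).trans hzero
    simp only [fetchTimes, fetch, raise, Program.block, wp,
      setReg_reg_code, State.setReg_mem, Op.eval, reduceCtorEq, if_true, if_false, hjob', hmem,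
      hmax', htotal', hright', hone', hzero', hak, hbk, add_tsub_eq_max, true_and]
    have hsub : range k ⊆ range n := range_subset_range.2 hk.le
    have htotal_le := sum_le_mul_pow hsub hfit.right_le
    have hright_le := sum_le_mul_pow ((filter_subset (fun j => ¬a j = 0) _).trans hsub)
      hfit.right_le
    have hsup_le : (range k).sup (fun j => max (a j) (b j)) ≤ P := Finset.sup_le fun j hj =>
      max_le (hfit.left_le j (mem_range.1 (hsub hj))) (hfit.right_le j (mem_range.1 (hsub hj)))
    have hPow : P ≤ P ^ 4 := Nat.le_self_pow (by omega) P
    have hle := hfit.le_mul_pow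
    have hstep : ∑ j ∈ range (k + 1) with ¬a j = 0, b j =
        (∑ j ∈ range k with ¬a j = 0, b j) + if ¬a k = 0 then b k else 0 := by
      simp only [sum_filter, sum_range_succ]
    rw [sum_range_succ, hstep, range_add_one, sup_insert]
    obtain ⟨hpos, ha, hb, hB⟩ := hfit
    specialize ha k hk
    specialize hb k hk
    split_ifs <;> omega

theorem reaches_prepare (hfit : Fits B n P a b) (hjobs : s.reg jobs = n) (hzero : s.reg zero = 0)
    (hone : s.reg one = 1) (hmax : s.reg maxTime = P) (htotal : s.reg total = ∑ j ∈ range n, b j) :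
    Reaches B 10 prepare s fun s' => HasConstants n P b s' ∧ s'.mem = s.mem := by
  refine Reaches.of_wp (by decide) ?_
  have hle := hfit.le_mul_pow
  have hPow₂ : P ^ 2 ≤ P ^ 4 := Nat.pow_le_pow_right hfit.pos (by omega)
  have hPow₃ : P ^ 3 ≤ P ^ 4 := Nat.pow_le_pow_right hfit.pos (by omega)
  have hPow : 0 < P ^ 4 := Nat.pow_pos hfit.pos
  have hsquare : (P ^ 2) ^ 2 = P ^ 4 := by rw [← pow_mul]
  have hB := hfit.bound
  simp only [prepare, Program.block, wp, setReg_reg_code,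
    State.setReg_mem, Op.eval, reduceCtorEq, if_true, if_false, hmax, hjobs, hone, ← pow_two,
    ← pow_succ, Nat.reduceAdd, hsquare]
  refine ⟨by omega, by omega, by omega, by omega, by omega, by omega, by omega, by omega, by omega,
    ?_, trivial⟩
  constructor <;> simp only [setReg_reg_code, reduceCtorEq, if_true, if_false] <;> omega

/-- The numbers `l` and `r` and the memory `m` describe the schedule that runs the jobs in `G` on
the first machine, and the memory has not been used otherwise. -/
structure Describes (n : ℕ) (a b : ℕ → ℕ) (G : Finset ℕ) (l r : ℕ) (m : ℕ → ℕ) : Prop where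
  left : l = ∑ j ∈ G, a j
  right : r = ∑ j ∈ range n \ G, b j
  input : IsInput n a b m
  times : IsArray (2 * n) n (restrict a G) m
  empty : ∀ x ≥ 3 * n, m x = 0

theorem Describes.insert {G : Finset ℕ} {l r k : ℕ} {m : ℕ → ℕ} (h : Describes n a b G l r m)
    (hk : k < n) (hkG : k ∉ G) :
    Describes n a b (insert k G) (l + a k) (r - b k) (Function.update m (2 * n + k) (a k)) where
  left := by rw [sum_insert hkG, h.left, add_comm]
  right := by
    have hk' : k ∈ range n \ G := mem_sdiff.2 ⟨mem_range.2 hk, hkG⟩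
    rw [sdiff_insert, h.right, ← add_sum_erase _ _ hk', Nat.add_sub_cancel_left]
  input := h.input.update (by omega)
  times := h.times.update (fun j _ hj => by simp only [restrict, mem_insert, hj, false_or])
    (if_pos (mem_insert_self k G))
  empty x hx := by rw [Function.update_of_ne (by omega), h.empty x hx]

theorem reaches_greedyStep (hfit : Fits B n P a b) (hc : HasConstants n P b s) {k r : ℕ}
    (hk : k < n) (hr : 0 < r) {G : Finset ℕ} (hG : IsGreedy n P a b r k G)
    (hs : Describes n a b G (s.reg left) (s.reg right) s.mem)
    (hjob : s.reg job = k) (hlevel : s.reg level = r) :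
    Reaches B 20 greedyStep s fun s' => ∃ G', IsGreedy n P a b r (k + 1) G' ∧
      Describes n a b G' (s'.reg left) (s'.reg right) s'.mem := by
  refine Reaches.of_wp (by decide) ?_
  obtain ⟨hak, hbk⟩ := hs.input k hk
  have hle := hfit.le_mul_pow
  have hleft_le := hs.left.trans_le (sum_le_mul_pow hG.subset hfit.left_le)
  have hright_le := hs.right.trans_le (sum_le_mul_pow sdiff_subset hfit.right_le)
  have haP := hfit.left_le k hk
  have hbP := hfit.right_le k hk
  have hPow : P ≤ P ^ 4 := Nat.le_self_pow (by omega) P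
  have haPow : a k * P ^ 2 ≤ P ^ 4 :=
    (Nat.mul_le_mul_right _ haP).trans
      (by rw [← pow_succ']; exact Nat.pow_le_pow_right hfit.pos (by omega))
  have hdiv_le : a k * P ^ 2 / b k ≤ a k * P ^ 2 := Nat.div_le_self _ _
  have hB := hfit.bound
  simp only [greedyStep, put, fetchTimes, fetch, Program.block, wp,
    setReg_reg_code, State.setReg_mem, State.setMem_reg, State.setMem_mem, Op.eval, reduceCtorEq,
    if_true, if_false, hjob, hlevel, hc.one, hc.square, hc.twice, hak, hbk]
  have hskip (h : ¬(ratio P a b k = r ∧ s.reg left < s.reg right)) :=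
    hG.succ_right_of_not (hs.left ▸ hs.right ▸ h)
  refine ⟨by omega, by omega, by omega, by omega, ?_⟩
  split_ifs with hlt hgt hload
  · exact ⟨G, hskip fun h => hlt.ne h.1, hs⟩
  · exact ⟨G, hskip fun h => hgt.ne' h.1, hs⟩
  · have hratio : ratio P a b k = r := by rw [ratio]; omega
    rw [hs.left, hs.right] at hload
    exact ⟨by omega, by omega, by omega, _, hG.move hload hk hr hratio haP hbP,
      hs.insert hk (hG.notMem hload hr hratio)⟩
  · exact ⟨G, hskip fun h => hload h.2, hs⟩

theorem reaches_greedyRow (hfit : Fits B n P a b) (hc : HasConstants n P b s) {r : ℕ} (hr : 0 < r)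
    {G : Finset ℕ} (hG : IsGreedy n P a b r 0 G)
    (hs : Describes n a b G (s.reg left) (s.reg right) s.mem) (hlevel : s.reg level = r) :
    Reaches B (n * 22 + 3) (.block [move job zero, .forLoop job jobs one greedyStep]) s fun s' =>
      ∃ G', IsGreedy n P a b (r + 1) 0 G' ∧
        Describes n a b G' (s'.reg left) (s'.reg right) s'.mem := by
  refine Reaches.mono (N := 1 + ((n - 0) * 22 + 1)) ?_ (by omega) fun _ => id
  refine Reaches.seq (R := fun s' => s'.reg job = 0 ∧
    Describes n a b G (s'.reg left) (s'.reg right) s'.mem) ?_ fun s₁ hagree ⟨hjob, hs₁⟩ => ?_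
  · refine Reaches.of_wp (by decide) ?_
    simp only [move, wp, setReg_reg_code, State.setReg_mem, Op.eval, reduceCtorEq, if_true,
      if_false, hc.zero, add_zero, true_and]
    exact ⟨Nat.zero_le B, hs⟩
  have hc₁ := hc.of_agreeOff hagree (by decide)
  refine (Reaches.forLoop (I := fun k s' => ∃ G', IsGreedy n P a b r k G' ∧
      Describes n a b G' (s'.reg left) (s'.reg right) s'.mem) (by decide) (by decide) hjob hc₁.jobs
    hc₁.one (by omega) ⟨G, hG, hs₁⟩ fun k s' _ hk hjob' hagree' ⟨G', hG', hs'⟩ => ?_).mono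
      le_rfl fun _ ⟨G', hG', hs'⟩ => ⟨G', hG'.succ_left, hs'⟩
  have hlevel' : s'.reg level = r :=
    (hagree' _ (by decide)).trans ((hagree _ (by decide)).trans hlevel)
  refine (reaches_greedyStep hfit (hc₁.of_agreeOff hagree' (by decide)) hk hr hG' hs' hjob'
    hlevel').mono le_rfl fun s'' h => ?_
  simpa only [setReg_reg_code, State.setReg_mem, reduceCtorEq, if_false] using h

theorem reaches_greedy (hfit : Fits B n P a b) (hc : HasConstants n P b s)
    (hs : Describes n a b {j ∈ range n | a j = 0} (s.reg left) (s.reg right) s.mem) :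
    Reaches B (P ^ 3 * (n * 22 + 5) + 3) greedy s fun s' =>
      ∃ G, IsGreedy n P a b (P ^ 3 + 1) 0 G ∧
        Describes n a b G (s'.reg left) (s'.reg right) s'.mem := by
  refine Reaches.mono (N := 1 + ((P ^ 3 + 1 - 1) * (n * 22 + 5) + 1)) ?_
    (by rw [Nat.add_sub_cancel]; omega) fun _ => id
  refine Reaches.seq (R := fun s' => s'.reg level = 1 ∧
    Describes n a b {j ∈ range n | a j = 0} (s'.reg left) (s'.reg right) s'.mem) ?_
    fun s₁ hagree ⟨hlevel, hs₁⟩ => ?_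
  · refine Reaches.of_wp (by decide) ?_
    simp only [move, wp, setReg_reg_code, State.setReg_mem, Op.eval, reduceCtorEq, if_true,
      if_false, hc.zero, hc.one, true_and]
    have := hfit.bound
    have := Nat.pow_pos (n := 4) hfit.pos
    exact ⟨by omega, hs⟩
  have hc₁ := hc.of_agreeOff hagree (by decide)
  refine Reaches.forLoop (I := fun r s' => ∃ G, IsGreedy n P a b r 0 G ∧
    Describes n a b G (s'.reg left) (s'.reg right) s'.mem) (by decide) (by decide) hlevel
    hc₁.last hc₁.one (by omega) ⟨_, isGreedy_one_zero n P a b, hs₁⟩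
    fun r s' hr _ hlevel' hagree' ⟨G, hG, hs'⟩ => ?_
  refine (reaches_greedyRow hfit (hc₁.of_agreeOff hagree' (by decide)) (by omega) hG hs'
    hlevel').mono le_rfl fun s'' h => ?_
  simpa only [setReg_reg_code, State.setReg_mem, reduceCtorEq, if_false] using h

/-- The memory `m` holds the input, the times on the first machine in the schedule `G`, and the
entries of `savings n a b G (P ^ 4)` up to `(k, y)`. -/
structure HoldsTable (n P : ℕ) (a b : ℕ → ℕ) (G : Finset ℕ) (k y : ℕ) (m : ℕ → ℕ) : Prop where
  input : IsInput n a b m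
  times : IsArray (2 * n) n (restrict a G) m
  table : IsTable (3 * n) (9 * P ^ 4) (savings n a b G (P ^ 4)) k y m

/-- The registers that describe job `k` and row `k` of the table are up to date. -/
structure HasJob (n P : ℕ) (a b : ℕ → ℕ) (G : Finset ℕ) (k : ℕ) (s : State) : Prop where
  time₀ : s.reg time₀ = a k
  time₁ : s.reg time₁ = b k
  offset : s.reg offset = restrict a G k
  row : s.reg row = 3 * n + k * (9 * P ^ 4)

variable {G : Finset ℕ} {k l y z : ℕ}

theorem HasJob.of_agreeOff {r : List ℕ} {s' : State} (h : HasJob n P a b G k s)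
    (hagree : s.AgreeOff r s')
    (hr : ∀ x ∈ [Reg.time₀, Reg.time₁, Reg.offset, Reg.row], x.code ∉ r) :
    HasJob n P a b G k s' where
  time₀ := (hagree _ (hr _ (by decide))).trans h.time₀
  time₁ := (hagree _ (hr _ (by decide))).trans h.time₁
  offset := (hagree _ (hr _ (by decide))).trans h.offset
  row := (hagree _ (hr _ (by decide))).trans h.row

theorem Fits.row_le (h : Fits B n P a b) (hk : k ≤ n) :
    3 * n + k * (9 * P ^ 4) + 9 * P ^ 4 ≤ B := by
  have hrow : k * (9 * P ^ 4) ≤ n * (9 * P ^ 4) := Nat.mul_le_mul_right _ hk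
  rw [Nat.mul_left_comm n] at hrow
  have := h.bound
  have := h.le_mul_pow
  omega

theorem reaches_fetchJob (hfit : Fits B n P a b) (hc : HasConstants n P b s) (hk : k < n)
    (hinput : IsInput n a b s.mem) (htime : s.mem (2 * n + k) = restrict a G k)
    (hjob : s.reg job = k) (hrow : s.reg row = 3 * n + k * (9 * P ^ 4)) :
    Reaches B 8 fetchJob s fun s' => HasJob n P a b G k s' ∧ s'.mem = s.mem := by
  refine Reaches.of_wp (by decide) ?_
  obtain ⟨hak, hbk⟩ := hinput k hk
  have hrow_le := hfit.row_le hk.le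
  simp only [fetchJob, fetchTimes, fetch, Program.block, wp, setReg_reg_code, State.setReg_mem,
    Op.eval, reduceCtorEq, if_true, if_false, hjob, hc.one, hc.twice, hak, hbk, htime]
  refine ⟨by omega, by omega, by omega, ?_, trivial⟩
  constructor <;> simp only [setReg_reg_code, reduceCtorEq, if_true, if_false, hrow]

theorem savings_le (hfit : Fits B n P a b) (hk : k ≤ n) :
    savings n a b G (P ^ 4) k z ≤ 2 * (n * P ^ 4) + 1 := by
  have htable := table_le (a := a) (b := b) (c := restrict a G) (Q := P ^ 4)
    (D := ∑ j ∈ range n, b j + 1) (x := z) k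
  have hsum := sum_le_mul_pow (Subset.refl (range n)) hfit.right_le
  have hsum' := sum_le_mul_pow (range_subset_range.2 hk) hfit.right_le
  rw [savings]
  omega

theorem reaches_fetchSources (hfit : Fits B n P a b) (hk : k < n) (hj : HasJob n P a b G k s)
    (hs : IsTable (3 * n) (9 * P ^ 4) (savings n a b G (P ^ 4)) l y s.mem) (hkl : k < l) {x : Reg}
    (hx : s.reg x = z) (hz : P ^ 4 ≤ z) (hz' : z < 8 * P ^ 4) :
    Reaches B 6 (fetchSources x) s fun s' => s'.mem = s.mem ∧
      s'.reg val = savings n a b G (P ^ 4) k (z + restrict a G k) ∧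
      s'.reg quot = savings n a b G (P ^ 4) k (z + restrict a G k - a k) + b k := by
  refine Reaches.of_wp le_rfl ?_
  have hak : a k ≤ P ^ 4 := (hfit.left_le k hk).trans (Nat.le_self_pow (by omega) P)
  have hbk : b k ≤ P ^ 4 := (hfit.right_le k hk).trans (Nat.le_self_pow (by omega) P)
  have hck := restrict_le a G k
  have hget₀ : s.mem (3 * n + k * (9 * P ^ 4) + z + restrict a G k) =
      savings n a b G (P ^ 4) k (z + restrict a G k) := by
    rw [add_assoc, add_assoc]
    exact hs.get hkl (by omega)
  have hget₁ : s.mem (3 * n + k * (9 * P ^ 4) + z + restrict a G k - a k) =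
      savings n a b G (P ^ 4) k (z + restrict a G k - a k) := by
    rw [add_assoc, add_assoc, Nat.add_sub_assoc (by omega), Nat.add_sub_assoc (by omega)]
    exact hs.get hkl (by omega)
  simp only [fetchSources, Program.block, wp, setReg_reg_code, State.setReg_mem, Op.eval,
    reduceCtorEq, if_true, if_false, hx, hj.row, hj.offset, hj.time₀, hj.time₁, hget₀, hget₁,
    and_true]
  have hrow_le := hfit.row_le hk.le
  have hsav := savings_le (G := G) (z := z + restrict a G k - a k) hfit hk.le
  have hB := hfit.bound
  omega

theorem HoldsTable.update (h : HoldsTable n P a b G k y s.mem) (hy : y < 9 * P ^ 4) {v : ℕ}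
    (hv : v = savings n a b G (P ^ 4) k y) :
    HoldsTable n P a b G k (y + 1) (s.setMem (3 * n + k * (9 * P ^ 4) + y) v).mem where
  input := h.input.update (by omega)
  times := h.times.update_of_le (by omega)
  table := by rw [add_assoc]; exact h.table.update hy hv

theorem HoldsTable.succ_left (h : HoldsTable n P a b G (k + 1) (8 * P ^ 4) s.mem) :
    HoldsTable n P a b G (k + 2) (P ^ 4) s.mem where
  input := h.input
  times := h.times
  table := h.table.mono_of_eq_zero (.inl (by omega)) fun i x _ hi hi' => by
    obtain ⟨i, rfl⟩ : ∃ j, i = j + 1 := Nat.exists_eq_succ_of_ne_zero (by omega)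
    rw [savings, Makespan.table, if_neg (by omega)]

theorem reaches_fillEntry (hfit : Fits B n P a b) (hk : k < n) (hj : HasJob n P a b G k s)
    (hs : HoldsTable n P a b G (k + 1) y s.mem) (hentry : s.reg entry = y)
    (hnext : s.reg next = 3 * n + (k + 1) * (9 * P ^ 4)) (hy : P ^ 4 ≤ y) (hy' : y < 8 * P ^ 4) :
    Reaches B 12 fillEntry s fun s' => HoldsTable n P a b G (k + 1) (y + 1) s'.mem := by
  refine Reaches.mono (N := 6 + 6) ?_ le_rfl fun _ => id
  refine (reaches_fetchSources hfit hk hj hs.table (Nat.lt_succ_self k) hentry hy hy').seq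
    fun s' hagree ⟨hmem, hval, hquot⟩ => Reaches.of_wp (by decide) ?_
  have hnext' := (hagree next (by decide)).trans hnext
  have hentry' := (hagree entry (by decide)).trans hentry
  have hstep : savings n a b G (P ^ 4) (k + 1) y =
      max (savings n a b G (P ^ 4) k (y + restrict a G k))
        (savings n a b G (P ^ 4) k (y + restrict a G k - a k) + b k) := by
    rw [savings, table, if_pos ⟨hy, hy'⟩]
  simp only [raise, put, Program.block, wp, setReg_reg_code, Op.eval, reduceCtorEq,
    if_true, if_false, hval, hquot, hnext', hentry', add_tsub_eq_max, ← hstep]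
  have hsav := savings_le (G := G) (k := k + 1) (z := y) hfit hk
  have hrow_le := hfit.row_le (k := k + 1) hk
  have hB := hfit.bound
  refine ⟨by omega, by omega, by omega, ?_⟩
  rw [← hmem] at hs
  exact hs.update (by omega) rfl

theorem reaches_fillRow (hfit : Fits B n P a b) (hc : HasConstants n P b s) (hk : k < n)
    (hs : HoldsTable n P a b G (k + 1) (P ^ 4) s.mem) (hjob : s.reg job = k)
    (hrow : s.reg row = 3 * n + k * (9 * P ^ 4)) :
    Reaches B (98 * P ^ 4 + 12) fillRow s fun s' =>
      s'.reg row = 3 * n + (k + 1) * (9 * P ^ 4) ∧ HoldsTable n P a b G (k + 2) (P ^ 4) s'.mem := by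
  have hrow_le := hfit.row_le hk.le
  refine Reaches.mono (N := (8 + 2) + (((8 * P ^ 4 - P ^ 4) * (12 + 2) + 1) + 1)) ?_ (by omega)
    fun _ => id
  refine Reaches.seq (R := fun s' => HasJob n P a b G k s' ∧
    HoldsTable n P a b G (k + 1) (P ^ 4) s'.mem ∧
    s'.reg next = 3 * n + (k + 1) * (9 * P ^ 4) ∧ s'.reg entry = P ^ 4) ?_
    fun s₁ hagree ⟨hj₁, hs₁, hnext₁, hentry₁⟩ => ?_
  · refine (reaches_fetchJob hfit hc hk hs.input (hs.times k hk) hjob hrow).seq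
      fun s₁ hagree ⟨hj₁, hmem⟩ => Reaches.of_wp (by decide) ?_
    have hc₁ := hc.of_agreeOff hagree (by decide)
    simp only [move, Program.block, wp, setReg_reg_code, State.setReg_mem, Op.eval, reduceCtorEq,
      if_true, if_false, hc₁.width, hc₁.low, hc₁.zero, hj₁.row, hmem]
    refine ⟨by omega, by omega, ⟨?_, ?_, ?_, ?_⟩, hs, by rw [Nat.succ_mul k, add_assoc], rfl⟩ <;>
      simp only [setReg_reg_code, reduceCtorEq, if_false, hj₁.time₀, hj₁.time₁, hj₁.offset, hj₁.row]
  have hc₁ := hc.of_agreeOff hagree (by decide)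
  refine (Reaches.forLoop (I := fun y s' => HoldsTable n P a b G (k + 1) y s'.mem)
    (by decide) (by decide) hentry₁ hc₁.top hc₁.one (by omega) hs₁
    fun y s' hy hy' hentry' hagree' hs' => ?_).seq fun s₂ hagree₂ hs₂ => ?_
  · exact reaches_fillEntry hfit hk (hj₁.of_agreeOff hagree' (by decide)) hs' hentry'
      ((hagree' next (by decide)).trans hnext₁) hy hy'
  · refine Reaches.of_wp (by decide) ?_
    have hrow_le' := hfit.row_le (k := k + 1) hk
    have hc₂ := hc₁.of_agreeOff hagree₂ (by decide)
    have hnext₂ := (hagree₂ next (by decide)).trans hnext₁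
    simp only [move, Program.block, wp, setReg_reg_code, State.setReg_mem, Op.eval, if_true, hnext₂,
      hc₂.zero, add_zero, true_and]
    exact ⟨by omega, HoldsTable.succ_left hs₂⟩

theorem isTable_savings_init {m : ℕ → ℕ} (hP : 0 < P) (hempty : ∀ x ≥ 3 * n, m x = 0) :
    IsTable (3 * n) (9 * P ^ 4) (savings n a b G (P ^ 4)) 1 (P ^ 4)
      (Function.update m (3 * n + 4 * P ^ 4) (∑ j ∈ range n, b j + 1)) := by
  have hpos := Nat.pow_pos (n := 4) hP
  have hzero : IsTable (3 * n) (9 * P ^ 4) (savings n a b G (P ^ 4)) 0 (4 * P ^ 4) m := by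
    intro i x _
    rw [hempty _ (by omega), savings]
    split_ifs with hix
    · obtain ⟨rfl, hx⟩ : i = 0 ∧ x < 4 * P ^ 4 := by omega
      rw [table, if_neg hx.ne]
    · rfl
  have hput := hzero.update (v := ∑ j ∈ range n, b j + 1) (by omega)
    (by rw [savings, table, if_pos rfl])
  rw [zero_mul, zero_add] at hput
  refine hput.mono_of_eq_zero (.inl zero_lt_one) fun i x _ hix hix' => ?_
  rw [savings]
  match i, hix' with
  | 0, _ => rw [table, if_neg (by omega)]
  | 1, _ => rw [table, if_neg (by omega)]
  | i + 2, _ => omega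

theorem reaches_fillTable (hfit : Fits B n P a b) (hc : HasConstants n P b s)
    (hinput : IsInput n a b s.mem) (htimes : IsArray (2 * n) n (restrict a G) s.mem)
    (hempty : ∀ x ≥ 3 * n, s.mem x = 0) :
    Reaches B (n * (98 * P ^ 4 + 14) + 6) fillTable s fun s' =>
      s'.reg row = 3 * n + n * (9 * P ^ 4) ∧ HoldsTable n P a b G (n + 1) (P ^ 4) s'.mem := by
  refine Reaches.mono (N := 5 + ((n - 0) * (98 * P ^ 4 + 12 + 2) + 1)) ?_
    (le_of_eq (by rw [Nat.sub_zero]; ring)) fun _ => id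
  refine Reaches.seq (R := fun s' => s'.reg row = 3 * n + 0 * (9 * P ^ 4) ∧
    HoldsTable n P a b G 1 (P ^ 4) s'.mem ∧ s'.reg job = 0) ?_
    fun s₁ hagree ⟨hrow₁, hs₁, hjob₁⟩ => ?_
  · refine Reaches.of_wp (by decide) ?_
    have hsum := sum_le_mul_pow (Subset.refl (range n)) hfit.right_le
    have hle := hfit.le_mul_pow
    have hpos := Nat.pow_pos (n := 4) hfit.pos
    have hB := hfit.bound
    simp only [put, move, Program.block, wp, setReg_reg_code, State.setReg_mem, State.setMem_reg,
      State.setMem_mem, Op.eval, reduceCtorEq, if_true, if_false, hc.twice, hc.jobs, hc.total,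
      hc.one, hc.mid, hc.zero]
    refine ⟨by omega, by omega, by omega, by omega, by omega, ⟨?_, ?_, ?_⟩, trivial⟩
    · exact hinput.update (by omega)
    · exact htimes.update_of_le (by omega)
    · rw [← Nat.succ_mul]
      exact isTable_savings_init hfit.pos hempty
  have hc₁ := hc.of_agreeOff hagree (by decide)
  refine (Reaches.forLoop (I := fun k s' => s'.reg row = 3 * n + k * (9 * P ^ 4) ∧
    HoldsTable n P a b G (k + 1) (P ^ 4) s'.mem) (by decide) (by decide) hjob₁ hc₁.jobs hc₁.one
    (Nat.zero_le n) ⟨hrow₁, hs₁⟩ fun k s' _ hk hjob' hagree' ⟨hrow', hs'⟩ => ?_)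
  refine (reaches_fillRow hfit (hc₁.of_agreeOff hagree' (by decide)) hk hs' hjob' hrow').mono le_rfl
    fun s'' h => ?_
  simpa only [setReg_reg_code, State.setReg_mem, reduceCtorEq, if_false] using h

variable {R : Finset ℕ} {x : ℕ}

/-- No entry of the final row before `y` stands for a makespan below `u`, and if `u` is at most the
total time on the second machine, then it is the makespan that the entry at `x` stands for. -/
structure IsBest (n P : ℕ) (a b : ℕ → ℕ) (G : Finset ℕ) (y u x : ℕ) : Prop where
  le_rowCost : ∀ z, P ^ 4 ≤ z → z < y → u ≤ rowCost n a b G (P ^ 4) z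
  rowCost_eq : u ≤ ∑ j ∈ range n, b j →
    P ^ 4 ≤ x ∧ x < 8 * P ^ 4 ∧ rowCost n a b G (P ^ 4) x = u

theorem IsBest.succ {u : ℕ} (h : IsBest n P a b G y u x) (hle : u ≤ rowCost n a b G (P ^ 4) y) :
    IsBest n P a b G (y + 1) u x where
  le_rowCost z hz hzy := by
    obtain hzy | rfl := Nat.lt_succ_iff_lt_or_eq.1 hzy
    exacts [h.le_rowCost z hz hzy, hle]
  rowCost_eq := h.rowCost_eq

theorem IsBest.succ_of_lt {u : ℕ} (h : IsBest n P a b G y u x)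
    (hlt : rowCost n a b G (P ^ 4) y < u) (hy : P ^ 4 ≤ y) (hy' : y < 8 * P ^ 4) :
    IsBest n P a b G (y + 1) (rowCost n a b G (P ^ 4) y) y where
  le_rowCost z hz hzy := by
    obtain hzy | rfl := Nat.lt_succ_iff_lt_or_eq.1 hzy
    exacts [hlt.le.trans (h.le_rowCost z hz hzy), le_rfl]
  rowCost_eq _ := ⟨hy, hy', rfl⟩

theorem reaches_selectEntry (hfit : Fits B n P a b) (hc : HasConstants n P b s)
    (hs : HoldsTable n P a b G (n + 1) (P ^ 4) s.mem) (hrow : s.reg row = 3 * n + n * (9 * P ^ 4))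
    (hleft : s.reg left = ∑ j ∈ range n, restrict a G j)
    (hbest : IsBest n P a b G y (s.reg best) (s.reg arg)) (hentry : s.reg entry = y)
    (hy : P ^ 4 ≤ y) (hy' : y < 8 * P ^ 4) :
    Reaches B 12 selectEntry s fun s' =>
      s'.mem = s.mem ∧ IsBest n P a b G (y + 1) (s'.reg best) (s'.reg arg) := by
  refine Reaches.of_wp (by decide) ?_
  have hget : s.mem (3 * n + n * (9 * P ^ 4) + y) = savings n a b G (P ^ 4) n y := by
    rw [add_assoc]
    exact hs.table.get n.lt_succ_self (by omega)
  have hcost : max (2 * ∑ j ∈ range n, b j + 1 - savings n a b G (P ^ 4) n y)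
      (∑ j ∈ range n, restrict a G j + y - 4 * P ^ 4) = rowCost n a b G (P ^ 4) y :=
    max_comm _ _
  have hsum := sum_le_mul_pow (Subset.refl (range n)) hfit.right_le
  have hsum' := sum_le_mul_pow (f := restrict a G) (Subset.refl (range n)) fun j hj =>
    (restrict_le a G j).trans (hfit.left_le j hj)
  have hpos := Nat.pow_pos (n := 4) hfit.pos
  have hrow_le := hfit.row_le (le_refl n)
  have hB := hfit.bound
  simp only [selectEntry, fetch, raise, move, Program.block, wp, setReg_reg_code, State.setReg_mem,
    Op.eval, reduceCtorEq, if_true, if_false, hrow, hentry, hc.total, hc.one, hc.mid, hc.zero,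
    hleft, hget, add_tsub_eq_max, ← two_mul, hcost]
  refine ⟨by omega, by omega, by omega, by omega, by omega, by omega, by omega, by omega, ?_⟩
  simp only [add_zero]
  split_ifs with hlt
  · have hval : rowCost n a b G (P ^ 4) y ≤ B := by omega
    exact ⟨hval, by omega, trivial, hbest.succ_of_lt hlt hy hy'⟩
  · exact ⟨trivial, hbest.succ (not_lt.1 hlt)⟩

theorem reaches_select (hfit : Fits B n P a b) (hc : HasConstants n P b s)
    (hs : HoldsTable n P a b G (n + 1) (P ^ 4) s.mem) (hrow : s.reg row = 3 * n + n * (9 * P ^ 4))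
    (hleft : s.reg left = ∑ j ∈ range n, restrict a G j) :
    Reaches B (98 * P ^ 4 + 3) select s fun s' =>
      s'.mem = s.mem ∧ IsBest n P a b G (8 * P ^ 4) (s'.reg best) (s'.reg arg) := by
  refine Reaches.mono (N := 2 + ((8 * P ^ 4 - P ^ 4) * 14 + 1)) ?_ (by omega) fun _ => id
  refine Reaches.seq (R := fun s' => s'.mem = s.mem ∧ s'.reg entry = P ^ 4 ∧
    s'.reg best = ∑ j ∈ range n, b j + 1) ?_ fun s₁ hagree₁ ⟨hmem₁, hentry₁, hbest₁⟩ => ?_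
  · refine Reaches.of_wp (by decide) ?_
    have hsum := sum_le_mul_pow (Subset.refl (range n)) hfit.right_le
    have hpos := Nat.pow_pos (n := 4) hfit.pos
    have hB := hfit.bound
    simp only [move, Program.block, wp, setReg_reg_code, State.setReg_mem, Op.eval, reduceCtorEq,
      if_true, if_false, hc.total, hc.one, hc.low, hc.zero, add_zero, and_true]
    omega
  have hc₁ := hc.of_agreeOff hagree₁ (by decide)
  refine Reaches.forLoop (I := fun y s' => s'.mem = s.mem ∧
    IsBest n P a b G y (s'.reg best) (s'.reg arg)) (by decide) (by decide) hentry₁ hc₁.top hc₁.one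
    (by omega) ⟨hmem₁, fun z hz hz' => (hz.not_gt hz').elim, fun h => by rw [hbest₁] at h; omega⟩
    fun y s' hy hy' hentry' hagree' ⟨hmem', hbest'⟩ => ?_
  have hagree := (hagree₁.mono (by decide)).trans hagree'
  refine (reaches_selectEntry hfit (hc₁.of_agreeOff hagree' (by decide)) (by rwa [hmem'])
    ((hagree row (by decide)).trans hrow) ((hagree left (by decide)).trans hleft) hbest' hentry'
    hy hy').mono le_rfl fun s'' h => ?_
  simpa only [setReg_reg_code, State.setReg_mem, reduceCtorEq, if_false, hmem'] using h

/-- The state of the retracing: the jobs from `k` on have been assigned to the machines as in `R`,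
and an optimal schedule of the others is found at entry `x` of row `k`. -/
structure HoldsTrace (n P : ℕ) (a b : ℕ → ℕ) (G R : Finset ℕ) (k x : ℕ) (m : ℕ → ℕ) : Prop where
  input : IsInput n a b m
  times : IsArray (2 * n) n (fun j => if j < k then restrict a G j else if j ∈ R then 0 else 1) m
  table : IsTable (3 * n) (9 * P ^ 4) (savings n a b G (P ^ 4)) (n + 1) (P ^ 4) m
  sum_lt : ∑ j ∈ range k, b j < savings n a b G (P ^ 4) k x
  mem_iff : ∀ j < k,
    j ∈ R ↔ j ∈ choice a b (restrict a G) (P ^ 4) (∑ j ∈ range n, b j + 1) k x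

theorem HoldsTrace.step {m : ℕ → ℕ} (h : HoldsTrace n P a b G R (k + 1) x m) (hk : k < n) {v : ℕ}
    (hv : v = if Takes a b (restrict a G) (P ^ 4) (∑ j ∈ range n, b j + 1) k x then 0 else 1) :
    HoldsTrace n P a b G R k (source a b (restrict a G) (P ^ 4) (∑ j ∈ range n, b j + 1) k x)
      (Function.update m (2 * n + k) v) where
  input := h.input.update (by omega)
  times := by
    refine h.times.update (fun j _ hj => ?_) ?_
    · simp only [Nat.lt_succ_iff_lt_or_eq, hj, or_false]
    · simp only [lt_irrefl, if_false, h.mem_iff k k.lt_succ_self, self_mem_choice_succ, hv]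
  table := h.table.update_of_lt (by omega)
  sum_lt := (table_source_of_lt h.sum_lt).2.2.1
  mem_iff j hj := (h.mem_iff j (by omega)).trans (mem_choice_succ_of_lt hj)

theorem reaches_followEntry (hfit : Fits B n P a b) (hc : HasConstants n P b s) (hk : k < n)
    (hj : HasJob n P a b G k s) (hjob : s.reg job = k) (hx : s.reg arg = x)
    (hs : HoldsTrace n P a b G R (k + 1) x s.mem)
    (hval : s.reg val = savings n a b G (P ^ 4) k (x + restrict a G k))
    (hquot : s.reg quot = savings n a b G (P ^ 4) k (x + restrict a G k - a k) + b k) :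
    Reaches B 5 followEntry s fun s' => s'.reg row = 3 * n + k * (9 * P ^ 4) ∧
      HoldsTrace n P a b G R k (s'.reg arg) s'.mem := by
  refine Reaches.of_wp (by decide) ?_
  have hstep := fun v => hs.step (v := v) hk
  have htakes : Takes a b (restrict a G) (P ^ 4) (∑ j ∈ range n, b j + 1) k x ↔
      ¬ s.reg quot < s.reg val := by rw [hval, hquot, not_lt]; rfl
  have hck := restrict_le a G k
  have hak := hfit.left_le k hk
  have hPQ := Nat.le_self_pow (n := 4) (by omega) P
  have hxP := (table_source_of_lt hs.sum_lt).2.1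
  have hle := hfit.le_mul_pow
  have hB := hfit.bound
  simp only [source, htakes, ite_not] at hstep
  simp only [followEntry, put, Program.block, wp, setReg_reg_code, State.setReg_mem,
    State.setMem_reg, State.setMem_mem, Op.eval, reduceCtorEq, if_true, if_false, hj.row, hj.offset,
    hj.time₀, hjob, hx, hc.zero, hc.one, hc.twice, true_and]
  refine ⟨by omega, ?_⟩
  split_ifs at hstep ⊢
  · exact ⟨by omega, hstep 1 rfl⟩
  · exact ⟨by omega, by omega, hstep 0 rfl⟩

theorem reaches_traceStep (hfit : Fits B n P a b) (hc : HasConstants n P b s) (hk : k < n)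
    (hx : s.reg arg = x) (hs : HoldsTrace n P a b G R (k + 1) x s.mem)
    (hsteps : s.reg steps = n - (k + 1)) (hrow : s.reg row = 3 * n + (k + 1) * (9 * P ^ 4)) :
    Reaches B 22 traceStep s fun s' =>
      s'.reg row = 3 * n + k * (9 * P ^ 4) ∧ HoldsTrace n P a b G R k (s'.reg arg) s'.mem := by
  obtain ⟨hxP, hxP', -, -⟩ := table_source_of_lt hs.sum_lt
  refine Reaches.mono (N := 3 + (8 + (6 + 5))) ?_ le_rfl fun _ => id
  refine Reaches.seq (R := fun s' => s'.reg job = k ∧ s'.reg row = 3 * n + k * (9 * P ^ 4) ∧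
    s'.mem = s.mem) ?_ fun s₁ hagree₁ ⟨hjob₁, hrow₁, hmem₁⟩ => ?_
  · refine Reaches.of_wp (by decide) ?_
    have hrow_le := hfit.row_le (k := k + 1) hk
    rw [Nat.succ_mul k] at hrow hrow_le
    simp only [Program.block, wp, setReg_reg_code, State.setReg_mem, Op.eval, reduceCtorEq, if_true,
      if_false, hc.jobs, hc.one, hc.width, hsteps, hrow, and_true]
    omega
  rw [← hmem₁] at hs
  have hc₁ := hc.of_agreeOff hagree₁ (by decide)
  refine (reaches_fetchJob hfit hc₁ hk hs.input
    ((hs.times k hk).trans (if_pos k.lt_succ_self)) hjob₁ hrow₁).seq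
    fun s₂ hagree₂ ⟨hj₂, hmem₂⟩ => ?_
  rw [← hmem₂] at hs
  have hx₂ := (hagree₂ arg (by decide)).trans ((hagree₁ arg (by decide)).trans hx)
  refine (reaches_fetchSources hfit hk hj₂ hs.table (by omega) hx₂ hxP hxP').seq
    fun s₃ hagree₃ ⟨hmem₃, hval₃, hquot₃⟩ => ?_
  rw [← hmem₃] at hs
  exact reaches_followEntry hfit ((hc₁.of_agreeOff hagree₂ (by decide)).of_agreeOff hagree₃
    (by decide)) hk (hj₂.of_agreeOff hagree₃ (by decide)) ((hagree₃ job (by decide)).trans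
    ((hagree₂ job (by decide)).trans hjob₁)) ((hagree₃ arg (by decide)).trans hx₂) hs hval₃ hquot₃

theorem reaches_trace (hfit : Fits B n P a b) (hc : HasConstants n P b s)
    (hs : HoldsTrace n P a b G R n (s.reg arg) s.mem)
    (hrow : s.reg row = 3 * n + n * (9 * P ^ 4)) :
    Reaches B (n * 24 + 2) trace s fun s' =>
      IsArray (2 * n) n (fun j => if j ∈ R then 0 else 1) s'.mem := by
  refine Reaches.mono (N := 1 + ((n - 0) * 24 + 1)) ?_ (by omega) fun _ => id
  refine Reaches.seq (R := fun s' => s'.mem = s.mem ∧ s'.reg steps = 0) ?_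
    fun s₁ hagree ⟨hmem₁, hsteps₁⟩ => ?_
  · refine Reaches.of_wp (by decide) ?_
    simp only [move, wp, setReg_reg_code, State.setReg_mem, Op.eval, if_true, hc.zero, add_zero,
      zero_le, and_self]
  have hc₁ := hc.of_agreeOff hagree (by decide)
  rw [← hmem₁, ← hagree arg (by decide)] at hs
  refine (Reaches.forLoop (I := fun i s' => s'.reg row = 3 * n + (n - i) * (9 * P ^ 4) ∧
    HoldsTrace n P a b G R (n - i) (s'.reg arg) s'.mem) (by decide) (by decide) hsteps₁ hc₁.jobs
    hc₁.one (Nat.zero_le n) ⟨(hagree row (by decide)).trans hrow, hs⟩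
    fun i s' _ hi hsteps' hagree' ⟨hrow', hs'⟩ => ?_).mono le_rfl fun s' ⟨_, hs'⟩ => ?_
  · rw [show n - i = n - (i + 1) + 1 by omega] at hrow' hs'
    refine (reaches_traceStep hfit (hc₁.of_agreeOff hagree' (by decide)) (by omega) rfl hs'
      (by omega) hrow').mono le_rfl fun s'' h => ?_
    simpa only [setReg_reg_code, State.setReg_mem, reduceCtorEq, if_false] using h
  · simpa only [Nat.sub_self, Nat.not_lt_zero, if_false] using hs'.times

theorem reaches_copyOut {f : ℕ → ℕ} (hfit : Fits B n P a b) (hc : HasConstants n P b s)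
    (hs : IsArray (2 * n) n f s.mem) :
    Reaches B (n * 6 + 2) copyOut s fun s' => IsArray 0 n f s'.mem := by
  refine Reaches.mono (N := 1 + ((n - 0) * 6 + 1)) ?_ (by omega) fun _ => id
  refine Reaches.seq (R := fun s' => s'.mem = s.mem ∧ s'.reg job = 0) ?_
    fun s₁ hagree ⟨hmem₁, hjob₁⟩ => ?_
  · refine Reaches.of_wp (by decide) ?_
    simp only [move, wp, setReg_reg_code, State.setReg_mem, Op.eval, if_true, hc.zero, add_zero,
      zero_le, and_self]
  have hc₁ := hc.of_agreeOff hagree (by decide)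
  rw [← hmem₁] at hs
  refine (Reaches.forLoop (I := fun k s' => IsArray (2 * n) n f s'.mem ∧ IsArray 0 k f s'.mem)
    (by decide) (by decide) hjob₁ hc₁.jobs hc₁.one (Nat.zero_le n)
    ⟨hs, fun j hj => (Nat.not_lt_zero j hj).elim⟩
    fun k s' _ hk hjob' hagree' ⟨hs', hout⟩ => ?_).mono le_rfl fun s' => And.right
  have hc' := hc₁.of_agreeOff hagree' (by decide)
  refine Reaches.of_wp (by decide) ?_
  simp only [fetch, put, Program.block, wp, setReg_reg_code, State.setReg_mem, State.setMem_mem,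
    Op.eval, reduceCtorEq, if_true, if_false, hjob', hc'.twice, hc'.zero, hs' k hk]
  have hle := hfit.le_mul_pow
  have hB := hfit.bound
  refine ⟨by omega, by omega, hs'.update_of_lt (by omega), fun j hj => ?_⟩
  rw [add_zero, Function.update_apply]
  split_ifs with hjk
  · rw [← hjk, zero_add]
  · exact hout j (by omega)

theorem reaches_setup (hfit : Fits B n P a b) (hjobs : s.reg jobs = n)
    (hreg : ∀ x ≠ jobs, s.reg (Reg.code x) = 0) (hinput : IsInput n a b s.mem)
    (hempty : ∀ x ≥ 2 * n, s.mem x = 0) (hP : (range n).sup (fun j => max (a j) (b j)) ⊔ 1 = P) :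
    Reaches B (n * 32 + 13) setup s fun s' => HasConstants n P b s' ∧
      Describes n a b {j ∈ range n | a j = 0} (s'.reg left) (s'.reg right) s'.mem := by
  refine Reaches.mono (N := 2 + (n * 32 + 1 + 10)) ?_ (by omega) fun _ => id
  refine Reaches.seq (R := fun s' => s'.mem = s.mem ∧ s'.reg one = 1 ∧ s'.reg maxTime = 1) ?_
    fun s₁ hagree₁ ⟨hmem₁, hone₁, hmax₁⟩ => ?_
  · refine Reaches.of_wp (by decide) ?_
    simp only [Program.block, wp, setReg_reg_code, State.setReg_mem, reduceCtorEq, if_true,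
      if_false, and_true]
    have := hfit.bound
    have := Nat.pow_pos (n := 4) hfit.pos
    omega
  rw [← hmem₁] at hinput
  have hjobs₁ := (hagree₁ jobs (by decide)).trans hjobs
  have hzero₁ := (hagree₁ zero (by decide)).trans (hreg zero (by decide))
  refine (reaches_scan hfit hjobs₁ hzero₁ hone₁ hmax₁
    ((hagree₁ total (by decide)).trans (hreg total (by decide)))
    ((hagree₁ right (by decide)).trans (hreg right (by decide)))
    ((hagree₁ job (by decide)).trans (hreg job (by decide))) hinput).seq
    fun s₂ hagree₂ ⟨hmem₂, hmax₂, htotal₂, hright₂⟩ => ?_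
  refine (reaches_prepare hfit ((hagree₂ jobs (by decide)).trans hjobs₁)
    ((hagree₂ zero (by decide)).trans hzero₁) ((hagree₂ one (by decide)).trans hone₁)
    (hmax₂.trans hP) htotal₂).and_agreeOff.mono le_rfl fun s₃ ⟨⟨hc, hmem₃⟩, hagree₃⟩ => ⟨hc, ?_⟩
  have hmem : s₃.mem = s.mem := hmem₃.trans (hmem₂.trans hmem₁)
  have hleft := (hagree₃ left (by decide)).trans ((hagree₂ left (by decide)).trans
    ((hagree₁ left (by decide)).trans (hreg left (by decide))))
  refine ⟨hleft.trans (sum_eq_zero fun j hj => (mem_filter.1 hj).2).symm, ?_,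
    by rwa [hmem, ← hmem₁], fun j _ => ?_, fun x hx => by rw [hmem, hempty x (by omega)]⟩
  · rw [hagree₃ right (by decide), hright₂, filter_not]
  · rw [hmem, hempty _ (by omega), restrict]
    split_ifs with hjG
    · exact (mem_filter.1 hjG).2.symm
    · rfl

theorem IsBest.le_splitCost {u x : ℕ} (h : IsBest n P a b G (8 * P ^ 4) u x) (hP : 0 < P)
    (hG : IsReference (range n) P a b G) (ha : ∀ j < n, a j ≤ P) (hb : ∀ j < n, b j ≤ P)
    {T : Finset ℕ} (hT : T ⊆ range n) : u ≤ splitCost (range n) a b T := by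
  obtain ⟨y, hy, hy', hopt⟩ := exists_rowCost_le hG hP ha hb
  exact (h.le_rowCost y hy hy').trans (hopt T hT)

theorem IsBest.rowCost_le_sum_and_eq {u x : ℕ} (h : IsBest n P a b G (8 * P ^ 4) u x) (hP : 0 < P)
    (hG : IsReference (range n) P a b G) (ha : ∀ j < n, a j ≤ P) (hb : ∀ j < n, b j ≤ P) :
    rowCost n a b G (P ^ 4) x ≤ ∑ j ∈ range n, b j ∧ rowCost n a b G (P ^ 4) x = u := by
  have hu : u ≤ ∑ j ∈ range n, b j := by
    simpa [splitCost] using h.le_splitCost hP hG ha hb (empty_subset _)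
  have heq := (h.rowCost_eq hu).2.2
  exact ⟨heq ▸ hu, heq⟩

theorem reaches_search (hfit : Fits B n P a b) (hc : HasConstants n P b s)
    (hG : IsReference (range n) P a b G)
    (hs : Describes n a b G (s.reg left) (s.reg right) s.mem) :
    Reaches B (n * (98 * P ^ 4 + 14) + 98 * P ^ 4 + 9) search s fun s' =>
      s'.reg row = 3 * n + n * (9 * P ^ 4) ∧ ∃ R, IsOptimalSplit (range n) a b R ∧
        s'.reg best = splitCost (range n) a b R ∧ HoldsTrace n P a b G R n (s'.reg arg) s'.mem := by
  refine Reaches.mono (N := n * (98 * P ^ 4 + 14) + 6 + (98 * P ^ 4 + 3)) ?_ (by omega) fun _ => id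
  refine (reaches_fillTable hfit hc hs.input hs.times hs.empty).seq
    fun s₁ hagree₁ ⟨hrow₁, hs₁⟩ => ?_
  have hleft₁ : s₁.reg left = ∑ j ∈ range n, restrict a G j := by
    rw [hagree₁ left (by decide), hs.left, sum_restrict a hG.subset]
  refine (reaches_select hfit (hc.of_agreeOff hagree₁ (by decide)) hs₁ hrow₁
    hleft₁).and_agreeOff.mono le_rfl fun s₂ ⟨⟨hmem₂, hbest⟩, hagree₂⟩ => ?_
  obtain ⟨hle, heq⟩ := hbest.rowCost_le_sum_and_eq hfit.pos hG hfit.left_le hfit.right_le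
  have hcost : splitCost (range n) a b (rowChoice n a b G (P ^ 4) (s₂.reg arg)) = s₂.reg best :=
    (splitCost_rowChoice (fun j hj => (hfit.left_le j hj).trans (Nat.le_self_pow (by omega) P))
      hle).trans heq
  refine ⟨(hagree₂ row (by decide)).trans hrow₁, _, ⟨rowChoice_subset, fun T hT => ?_⟩, hcost.symm,
    ?_⟩
  · exact hcost.trans_le (hbest.le_splitCost hfit.pos hG hfit.left_le hfit.right_le hT)
  · rw [hmem₂]
    exact ⟨hs₁.input, fun j hj => (hs₁.times j hj).trans (if_pos hj).symm, hs₁.table,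
      sum_lt_savings hle, fun _ _ => Iff.rfl⟩

theorem reaches_output (hfit : Fits B n P a b) (hc : HasConstants n P b s)
    (hs : HoldsTrace n P a b G R n (s.reg arg) s.mem) (hrow : s.reg row = 3 * n + n * (9 * P ^ 4)) :
    Reaches B (n * 30 + 5) output s fun s' =>
      IsArray 0 n (fun j => if j ∈ R then 0 else 1) s'.mem ∧ s'.reg jobs = s.reg best := by
  intro hbounded
  have hbest := hbounded.reg best
  revert hbounded
  refine Reaches.mono (N := n * 24 + 2 + (n * 6 + 2 + 1)) ?_ (by omega) fun _ => id
  refine (reaches_trace hfit hc hs hrow).seq fun s₁ hagree₁ hs₁ => ?_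
  have hc₁ := hc.of_agreeOff hagree₁ (by decide)
  refine (reaches_copyOut hfit hc₁ hs₁).seq fun s₂ hagree₂ hs₂ => Reaches.of_wp (by decide) ?_
  have hbest₂ := (hagree₂ best (by decide)).trans (hagree₁ best (by decide))
  simp only [Program.block, move, wp, setReg_reg_code, State.setReg_mem, Op.eval, if_true, hbest₂,
    (hc₁.of_agreeOff hagree₂ (by decide)).zero, add_zero, and_true]
  exact ⟨hbest, hs₂⟩

theorem reaches_solver (hfit : Fits B n P a b) (hjobs : s.reg jobs = n)
    (hreg : ∀ x ≠ jobs, s.reg (Reg.code x) = 0) (hinput : IsInput n a b s.mem)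
    (hempty : ∀ x ≥ 2 * n, s.mem x = 0) (hP : (range n).sup (fun j => max (a j) (b j)) ⊔ 1 = P) :
    Reaches B (200 * (n * P ^ 4 + P ^ 4)) solver s fun s' =>
      ∃ S, IsOptimalSplit (range n) a b S ∧ IsArray 0 n (fun j => if j ∈ S then 0 else 1) s'.mem ∧
        s'.reg jobs = splitCost (range n) a b S := by
  have hsteps : n * 32 + 13 + (P ^ 3 * (n * 22 + 5) + 3 + (n * (98 * P ^ 4 + 14) + 98 * P ^ 4 + 9 +
      (n * 30 + 5))) ≤ 200 * (n * P ^ 4 + P ^ 4) := by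
    have hpos := Nat.pow_pos (n := 4) hfit.pos
    have hle := hfit.le_mul_pow
    have hPow : P ^ 3 * (n * 22 + 5) ≤ P ^ 4 * (n * 22 + 5) :=
      Nat.mul_le_mul_right _ (Nat.pow_le_pow_right hfit.pos (by omega))
    linarith
  refine Reaches.mono ?_ hsteps fun _ => id
  refine (reaches_setup hfit hjobs hreg hinput hempty hP).seq fun s₁ _ ⟨hc₁, hs₁⟩ => ?_
  refine (reaches_greedy hfit hc₁ hs₁).seq fun s₂ hagree₂ ⟨G, hG, hs₂⟩ => ?_
  have hc₂ := hc₁.of_agreeOff hagree₂ (by decide)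
  refine (reaches_search hfit hc₂ (hG.isReference hfit.left_le hfit.right_le) hs₂).seq
    fun s₃ hagree₃ ⟨hrow₃, S, hS, hbest, hs₃⟩ => ?_
  refine (reaches_output hfit (hc₂.of_agreeOff hagree₃ (by decide)) hs₃ hrow₃).mono le_rfl
    fun s₄ ⟨hout, hjobs₄⟩ => ⟨S, hS, hout, hjobs₄.trans hbest⟩

end Phases

/-! ### Schedules as sets of jobs -/

section Instance

variable {n : ℕ} (p : Fin 2 → Fin n → ℕ)

/-- The times of the jobs on machine `i`, extended by `0` to all natural numbers. -/
def jobTime (i : Fin 2) (j : ℕ) : ℕ := if h : j < n then p i ⟨j, h⟩ else 0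

/-- The schedule that runs the jobs in `S` on the first machine and all others on the second one. -/
def assignment (n : ℕ) (S : Finset ℕ) (j : Fin n) : Fin 2 := if (j : ℕ) ∈ S then 0 else 1

theorem sum_jobTime (i : Fin 2) (q : ℕ → Prop) [DecidablePred q] :
    ∑ j ∈ range n with q j, jobTime p i j =
      ∑ j ∈ univ.filter (fun j : Fin n => q j), p i j := by
  simp only [sum_filter, jobTime, ← Fin.sum_univ_eq_sum_range, Fin.is_lt, dif_pos, Fin.eta]

theorem sup_jobTime :
    (range n).sup (fun j => max (jobTime p 0 j) (jobTime p 1 j)) = pmax p := by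
  refine eq_of_forall_ge_iff fun m => ?_
  simp only [pmax, Finset.sup_le_iff, mem_range, mem_univ, true_imp_iff, Fin.forall_fin_two,
    max_le_iff, ← forall_and]
  rw [Fin.forall_iff]
  exact forall₂_congr fun j hj => by rw [jobTime, jobTime, dif_pos hj, dif_pos hj]

theorem le_pmax (i : Fin 2) (j : Fin n) : p i j ≤ pmax p :=
  (le_sup (f := p i) (mem_univ j)).trans
    (le_sup (f := fun i => univ.sup fun j => p i j) (mem_univ i))

theorem jobTime_le_pmax (i : Fin 2) (j : ℕ) : jobTime p i j ≤ pmax p := by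
  rw [jobTime]
  split_ifs with hj
  · exact le_pmax p _ _
  · exact Nat.zero_le _

theorem makespan_assignment {S : Finset ℕ} (hS : S ⊆ range n) :
    makespan p (assignment n S) = splitCost (range n) (jobTime p 0) (jobTime p 1) S := by
  have h₀ : load p (assignment n S) 0 = ∑ j ∈ S, jobTime p 0 j := by
    rw [load, ← inter_eq_right.2 hS, ← filter_mem_eq_inter, sum_jobTime]
    simp [assignment]
  have h₁ : load p (assignment n S) 1 = ∑ j ∈ range n \ S, jobTime p 1 j := by
    rw [load, sdiff_eq_filter, sum_jobTime]
    simp [assignment]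
  simp [makespan, splitCost, Fin.univ_succ, h₀, h₁]

theorem exists_assignment_eq (τ : Fin n → Fin 2) : ∃ S ⊆ range n, assignment n S = τ := by
  refine ⟨(univ.filter fun j => τ j = 0).map Fin.valEmbedding, fun j hj => ?_, funext fun j => ?_⟩
  · obtain ⟨i, -, rfl⟩ := mem_map.1 hj
    exact mem_range.2 i.is_lt
  · have hmem : (j : ℕ) ∈ (univ.filter fun j => τ j = 0).map Fin.valEmbedding ↔ τ j = 0 := by
      rw [← Fin.valEmbedding_apply, mem_map', mem_filter, and_iff_right (mem_univ j)]
    rw [assignment]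
    split_ifs with hj
    · exact (hmem.1 hj).symm
    · exact (Fin.eq_one_of_ne_zero _ (mt hmem.2 hj)).symm

theorem IsOptimalSplit.isOptimal {p : Fin 2 → Fin n → ℕ} {S : Finset ℕ}
    (h : IsOptimalSplit (range n) (jobTime p 0) (jobTime p 1) S) :
    IsOptimal p (assignment n S) := by
  intro τ
  obtain ⟨T, hT, rfl⟩ := exists_assignment_eq τ
  rw [makespan_assignment p h.subset, makespan_assignment p hT]
  exact h.splitCost_le T hT

theorem isInput_inputState : IsInput n (jobTime p 0) (jobTime p 1) (inputState p).mem := by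
  intro j hj
  have h₀ : (j + j) / 2 = j ∧ (j + j) % 2 = 0 := by omega
  have h₁ : (j + j + 1) / 2 = j ∧ (j + j + 1) % 2 = 1 := by omega
  simp only [inputState, jobTime, h₀, h₁, dif_pos hj]
  exact ⟨rfl, rfl⟩

theorem inputState_boundedBy {B : ℕ} (hn : n ≤ B) (hp : pmax p ≤ B) :
    (inputState p).BoundedBy B where
  reg x := by
    simp only [inputState]
    split_ifs <;> omega
  mem x := by
    simp only [inputState]
    split_ifs with hx
    · exact (le_pmax p _ _).trans hp
    · exact Nat.zero_le B

theorem isSolution_of_isOptimalSplit {p : Fin 2 → Fin n → ℕ} {S : Finset ℕ} {s : State}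
    (hS : IsOptimalSplit (range n) (jobTime p 0) (jobTime p 1) S)
    (harray : IsArray 0 n (fun j => if j ∈ S then 0 else 1) s.mem)
    (hcost : s.reg 0 = splitCost (range n) (jobTime p 0) (jobTime p 1) S) : IsSolution p s := by
  refine ⟨assignment n S, hS.isOptimal, fun j => ?_, by rw [hcost, makespan_assignment p hS.subset]⟩
  have hcell := harray j j.is_lt
  rw [Nat.zero_add] at hcell
  simp only [hcell, assignment]
  split_ifs <;> rfl

theorem reaches_solver_inputState {B P : ℕ} (hP : max (pmax p) 1 = P)
    (hB : 32 * (n * P ^ 4 + P ^ 4) ≤ B) :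
    Reaches B (200 * (n * P ^ 4 + P ^ 4)) solver (inputState p) (IsSolution p) := by
  have hle : pmax p ≤ P ∧ 0 < P := by omega
  have hfit : Fits B n P (jobTime p 0) (jobTime p 1) :=
    ⟨hle.2, fun j _ => (jobTime_le_pmax p 0 j).trans hle.1,
      fun j _ => (jobTime_le_pmax p 1 j).trans hle.1, hB⟩
  refine (reaches_solver hfit rfl (fun x hx => if_neg fun h => hx (Reg.code_inj.1 h))
    (isInput_inputState p) (fun x hx => dif_neg (by omega)) (by rwa [sup_jobTime])).mono le_rfl
    fun s ⟨S, hS, harray, hcost⟩ => isSolution_of_isOptimalSplit hS harray hcost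

end Instance

theorem size_mul_pow_le {n P m : ℕ} (hn : n + 1 ≤ m) (hP : P ≤ m) (hm : 2 ≤ m) :
    (32 * (n * P ^ 4 + P ^ 4)).size ≤ 15 * Nat.log 2 m := by
  have hlog : 0 < Nat.log 2 m := Nat.log_pos Nat.one_lt_two hm
  have hlt : m < 2 ^ (Nat.log 2 m + 1) := Nat.lt_pow_succ_log_self Nat.one_lt_two m
  rw [Nat.size_le]
  calc 32 * (n * P ^ 4 + P ^ 4) = 32 * ((n + 1) * P ^ 4) := by ring
    _ ≤ 32 * (m * m ^ 4) := by gcongr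
    _ = 32 * m ^ 5 := by ring
    _ < 32 * (2 ^ (Nat.log 2 m + 1)) ^ 5 := by gcongr
    _ = 2 ^ (5 * Nat.log 2 m + 10) := by ring
    _ ≤ 2 ^ (15 * Nat.log 2 m) := Nat.pow_le_pow_right Nat.two_pos (by omega)

theorem mul_size_le {n P m : ℕ} (hn : n + 1 ≤ m) (hP : P ≤ m) (hm : 2 ≤ m) :
    200 * (n * P ^ 4 + P ^ 4) * (2 * (32 * (n * P ^ 4 + P ^ 4)).size + 1) ≤
      12400 * (P ^ 4 * max n 1) * Nat.log 2 m := by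
  have hlog : 0 < Nat.log 2 m := Nat.log_pos Nat.one_lt_two hm
  have hsize := size_mul_pow_le hn hP hm
  calc 200 * (n * P ^ 4 + P ^ 4) * (2 * (32 * (n * P ^ 4 + P ^ 4)).size + 1)
      = 200 * (P ^ 4 * (n + 1)) * (2 * (32 * (n * P ^ 4 + P ^ 4)).size + 1) := by ring
    _ ≤ 200 * (P ^ 4 * (2 * max n 1)) * (31 * Nat.log 2 m) := by gcongr <;> omega
    _ = 12400 * (P ^ 4 * max n 1) * Nat.log 2 m := by ring

theorem SolvesWithin.mono {c : Program} {T T' : (n : ℕ) → (Fin 2 → Fin n → ℕ) → ℕ}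
    (h : SolvesWithin c T) (hT : ∀ n p, T n p ≤ T' n p) : SolvesWithin c T' := by
  intro n p
  obtain ⟨s, t, hexec, hsol, ht⟩ := h n p
  exact ⟨s, t, hexec, hsol, ht.trans (hT n p)⟩

theorem solvesWithin_solver : SolvesWithin solver fun n p =>
    12400 * (max (pmax p) 1 ^ 4 * max n 1) * Nat.log 2 (n + pmax p + 2) := by
  intro n p
  obtain ⟨P, hP⟩ : ∃ P, max (pmax p) 1 = P := ⟨_, rfl⟩
  have hself : P ≤ P ^ 4 := Nat.le_self_pow (by omega) P
  have hn : n ≤ n * P ^ 4 := Nat.le_mul_of_pos_right n (by omega)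
  obtain ⟨s, t, hexec, ht, -, hsol⟩ := reaches_solver_inputState p hP le_rfl
    (inputState_boundedBy p (by omega) (by omega))
  refine ⟨s, t, hexec, hsol, ht.trans ?_⟩
  simp only [hP]
  exact mul_size_le (by omega) (by omega) (by omega)

end Makespan

theorem mainTheorem6_general :
    ∃ (c : RAM.Program) (K : ℕ), Makespan.SolvesWithin c fun n p =>
      K * (max (Makespan.pmax p) 1 ^ 4 * max n 1) * Nat.log 2 (n + Makespan.pmax p + 2) :=
  ⟨_, _, Makespan.solvesWithin_solver⟩

theorem mainTheorem6 :
    ∃ (c : RAM.Program) (K k : ℕ), Makespan.SolvesWithin c fun n p =>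
      K * (max (Makespan.pmax p) 1 ^ 6 * max n 1) *
        Nat.log 2 (n + Makespan.pmax p + 2) ^ k := by
  obtain ⟨c, K, hc⟩ := mainTheorem6_general
  refine ⟨c, K, 1, hc.mono fun n p => ?_⟩
  rw [pow_one]
  gcongr
  · exact le_max_right _ _
  · norm_num
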